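/- **Setting.** Let $E$ be a Polish space with Borel $\sigma$-algebra $\mathcal E$, $\pi$ a probability measure on $E$, and $\gamma$ a Markov kernel on $E$. Write $\mu(dx,dy)=\pi(dx)\gamma(x,dy)$ and let $\mu^{\top}$ be the image of $\mu$ under $(x,y)\mapsto(y,x)$. Let $t:E\times E\to[0,\infty)$ be a version of the Radon–Nikodym derivative $\frac{\pi(dy)\gamma(y,dx)}{\pi(dx)\gamma(x,dy)}$, i.e. $t$ is measurable and, with $R=\{t>0\}$: $t(y,x)=1/t(x,y)$ on $R$; $\mu^{\top}|_R=t\cdot\mu|_R$; and $\mu^{\top}|_{R^c}$, $\mu|_{R^c}$ are mutually singular (which is automatic if $\mu(R)=1$). Let $g:[0,\infty)\to[0,\infty)$ be a balancing function: $g(1)=1$, $g(0)=0$, $g(s)>0$ and $g(s)=s\,g(1/s)$ for $s>0$. Put $$\lambda(x)=\int_E g(t(x,y))\,\gamma(x,dy)\in[0,\infty],\qquad \Gamma_g(x,dy)=\frac{g(t(x,y))}{\lambda(x)}\,\gamma(x,dy)$$ (with $\Gamma_g(x,\cdot)=0$ if $\lambda(x)=\infty$). For $x\in\operatorname{supp}(\pi)$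 with $\lambda(x)<\infty$, the locally-balanced Markov jump process $Y$ started at $x$ is defined, under a probability $\mathbb P_x$, as follows: $(X_n)_{n\ge0}$ is a Markov chain with $X_0=x$ and transition kernel $\Gamma_g$; given $X$, the variables $\tau_n\sim\mathrm{Exp}(\lambda(X_{n-1}))$, $n\ge1$, are independent; $T_n=\tau_1+\dots+\tau_n$, $T_0=0$; $n_s=\sup\{n:T_n\le s\}$ is the number of jumps up to time $s$; and $Y_s=X_{n_s}$ if $s<\sup_nT_n$, while $Y_s=\partial$ (a graveyard state) otherwise. The laws $(\mathbb P_x)$ are given on a common measurable space carrying the variables $X_n,\tau_n$. Functions on $E$ are extended by $0$ at $\partial$. **Assumptions.** 1. $\lambda(x)>0$ for all $x\in\operatorname{supp}(\pi)$. 2. $g$ is non-decreasing and continuous. 3. There is a nonzero measure $\phi$ on $E$ such that for all $x\in\operatorname{supp}(\pi)$ with $\lambda(x)<\infty$ and all $B\in\mathcal E$ with $\phi(B)>0$ there is $n\ge 0$ with $\mathbb P_x(X_n\in B)>0$. 4. For all $x\in\operatorname{supp}(\pi)$ and $A\in\mathcal E$ with $\pi(A)=0$, $\Gamma_g(x,A)=0$.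 For bounded measurable $f:E\to\mathbb R$ let $Lf(x)=\int_E g(t(x,y))\,(f(y)-f(x))\,\gamma(x,dy)$ (set to $0$ where the integral is undefined). For measurable $f,h:E\to\mathbb R$ and a start $x$, say that *$(f,h)$ solves the martingale problem at $x$* if, $\mathbb P_x$-a.s., $r\mapsto h(Y_r)$ is integrable on $[0,s]$ for every $s\ge0$, and $$f(Y_s)-f(x)-\int_0^s h(Y_r)\,dr,\qquad s\ge0,$$ is a $\mathbb P_x$-martingale with respect to the natural filtration of $Y$. The *weak generator* of $Y$ is the set of pairs $(f,h)$ of measurable functions that solve the martingale problem at $\pi$-almost every $x$; its domain is the set of all $f$ for which such an $h$ exists. Let $S$ be the set of $x\in\operatorname{supp}(\pi)$ with $\lambda(x)<\infty$ and $\mathbb E_x[n_s]<\infty$ for all $s>0$. **Theorem (Weak generator).** Under Assumptions 1–4: (a) $\pi$-almost every $x$ belongs to $S$. (b) For every $x\in S$ and every bounded measurable $f:E\to\mathbb R$, the pair $(f,Lf)$ solves the martingale problem at $x$; that is, $f(Y_s)-f(x)-\int_0^sLf(Y_r)\,dr$ is a $\mathbb P_x$-martingale with respect to the natural filtration of $Y$.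 (c) Every bounded measurable $f$ lies in the domain of the weak generator, and the weak generator acts on it as $L$: for measurable $h$, the pair $(f,h)$ belongs to the weak generator if and only if $h=Lf$ $\pi$-almost everywhere. -/

import Mathlib

open MeasureTheory ProbabilityTheory
open scoped NNReal ENNReal

namespace LBMJP

noncomputable section

/-- The measure `[π ⊗ γ](dx, dy) = π(dx) γ(x, dy)` on `E × E`. -/
def flow {E : Type*} [MeasurableSpace E] (π : Measure E) (γ : Kernel E E) : Measure (E × E) :=
  π ⊗ₘ γ

/-- The measure `[π ⊗ γ](dy, dx) = π(dy) γ(y, dx)` on `E × E`: the image of `flow π γ` under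
the exchange of the two coordinates. -/
def revFlow {E : Type*} [MeasurableSpace E] (π : Measure E) (γ : Kernel E E) : Measure (E × E) :=
  (flow π γ).map Prod.swap

/-- `t` is a version of the Radon--Nikodym derivative
`t(x, y) = π(dy) γ(y, dx) / (π(dx) γ(x, dy))`, with the usual conventions: on
`R = {t > 0}` one has `t(y, x) = 1 / t(x, y)` and `t` is the density of `[π ⊗ γ](dy, dx)` with
respect to `[π ⊗ γ](dx, dy)`; off `R`, where `t = 0`, the two measures are mutually singular
(in particular this is the case if `[π ⊗ γ](R) = 1`). -/
structure IsRatio {E : Type*} [MeasurableSpace E] (π : Measure E) (γ : Kernel E E)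
    (t : E → E → ℝ≥0) : Prop where
  measurable : Measurable fun p : E × E => t p.1 p.2
  inv : ∀ x y, 0 < t x y → t y x = 1 / t x y
  density :
    (revFlow π γ).restrict {p | 0 < t p.1 p.2} =
      ((flow π γ).restrict {p | 0 < t p.1 p.2}).withDensity fun p => (t p.1 p.2 : ℝ≥0∞)
  singular :
    (revFlow π γ).restrict {p | 0 < t p.1 p.2}ᶜ ⟂ₘ (flow π γ).restrict {p | 0 < t p.1 p.2}ᶜ

/-- Balancing functions. -/
structure IsBalancing (g : ℝ≥0 → ℝ≥0) : Prop where
  map_one : g 1 = 1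
  map_zero : g 0 = 0
  pos : ∀ s, 0 < s → 0 < g s
  balance : ∀ s, 0 < s → g s = s * g (1 / s)

section Coefficients

variable {E : Type*} [MeasurableSpace E] (γ : Kernel E E) (t : E → E → ℝ≥0) (g : ℝ≥0 → ℝ≥0)

/-- The jump rate `λ(x) = ∫ g(t(x, y)) γ(x, dy) ∈ [0, ∞]`. -/
def rate (x : E) : ℝ≥0∞ := ∫⁻ y, (g (t x y) : ℝ≥0∞) ∂(γ x)

/-- The transition kernel `Γ_g(x, dy) = g(t(x, y)) / λ(x) γ(x, dy)` of the embedded chain (a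
probability measure if `0 < λ(x) < ∞`). -/
def jumpLaw (x : E) : Measure E :=
  (γ x).withDensity fun y => (g (t x y) : ℝ≥0∞) / rate γ t g x

/-- The operator `L f(x) = ∫ g(t(x, y)) (f(y) - f(x)) γ(x, dy)`. -/
def genL (f : E → ℝ) (x : E) : ℝ := ∫ y, (g (t x y) : ℝ) * (f y - f x) ∂(γ x)

end Coefficients

section JumpPaths

variable {E Ω : Type*}

/-- The jump times `T_n = τ_1 + ... + τ_n`, with `T_0 = 0` (the variable `τ 0` is not used). -/
def jumpTime (τ : ℕ → Ω → ℝ≥0) (n : ℕ) (ω : Ω) : ℝ≥0 := ∑ k ∈ Finset.range n, τ (k + 1) ω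

/-- The number of jumps `n_s = sup {n : T_n ≤ s} ∈ {0, 1, ..., ∞}` until time `s`. -/
def numJumps (τ : ℕ → Ω → ℝ≥0) (s : ℝ≥0) (ω : Ω) : ℕ∞ :=
  ⨆ (n : ℕ) (_ : jumpTime τ n ω ≤ s), (n : ℕ∞)

open Classical in
/-- The jump process on `E ∪ {∂}`, with `∂ = Sum.inr ()`: `Y_s = X_{n_s}` for `s < sup_n T_n`,
and `Y_s = ∂` otherwise. -/
def proc (X : ℕ → Ω → E) (τ : ℕ → Ω → ℝ≥0) (s : ℝ≥0) (ω : Ω) : E ⊕ Unit :=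
  if ∃ n, s < jumpTime τ n ω then Sum.inl (X (numJumps τ s ω).toNat ω) else Sum.inr ()

/-- The extension of `f : E → ℝ` to `E ∪ {∂}` by `f(∂) = 0`. -/
def extend (f : E → ℝ) : E ⊕ Unit → ℝ := Sum.elim f fun _ => 0

variable [MeasurableSpace E] [MeasurableSpace Ω]

/-- Under the law `P`, the sequences `X = (X_n)_{n ≥ 0}` and `τ = (τ_n)_{n ≥ 1}` are the embedded
chain and the holding times of the locally-balanced Markov jump process started at `x`:
`X` is a Markov chain with `X_0 = x` and transition kernel `Γ_g`, and, given `X`, the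
`τ_n` are independent with `τ_n ∼ Exp(λ(X_{n-1}))`. -/
structure IsLBMJP (γ : Kernel E E) (t : E → E → ℝ≥0) (g : ℝ≥0 → ℝ≥0) (x : E)
    (P : Measure Ω) (X : ℕ → Ω → E) (τ : ℕ → Ω → ℝ≥0) : Prop where
  prob : IsProbabilityMeasure P
  start : ∀ᵐ ω ∂P, X 0 ω = x
  chain : ∀ (n : ℕ) (A : ℕ → Set E) (B : Set E), (∀ i, MeasurableSet (A i)) → MeasurableSet B →
    P {ω | (∀ i ≤ n, X i ω ∈ A i) ∧ X (n + 1) ω ∈ B} =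
      ∫⁻ ω in {ω | ∀ i ≤ n, X i ω ∈ A i}, jumpLaw γ t g (X n ω) B ∂P
  holding : ∀ (n : ℕ) (A : ℕ → Set E) (B : ℕ → Set ℝ),
    (∀ i, MeasurableSet (A i)) → (∀ i, MeasurableSet (B i)) →
    P {ω | (∀ i ≤ n, X i ω ∈ A i) ∧ ∀ i ∈ Finset.Icc 1 n, (τ i ω : ℝ) ∈ B i} =
      ∫⁻ ω in {ω | ∀ i ≤ n, X i ω ∈ A i},
        ∏ i ∈ Finset.Icc 1 n, expMeasure (rate γ t g (X (i - 1) ω)).toReal (B i) ∂P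

theorem measurable_jumpTime {τ : ℕ → Ω → ℝ≥0} (hτ : ∀ n, Measurable (τ n)) (n : ℕ) :
    Measurable (jumpTime τ n) :=
  Finset.measurable_fun_sum _ fun k _ => hτ (k + 1)

theorem measurable_numJumps {τ : ℕ → Ω → ℝ≥0} (hτ : ∀ n, Measurable (τ n)) (s : ℝ≥0) :
    Measurable (numJumps τ s) := by
  have hB : BorelSpace ℕ∞ := by
    refine ⟨le_antisymm (fun A _ => ?_) le_top⟩
    have hA : ⋃ a ∈ A, {a} = A := Set.biUnion_of_singleton A
    rw [← hA]
    exact @MeasurableSet.biUnion _ _ (borel ℕ∞) _ _ A.to_countable fun a _ =>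
      (@MeasurableSet.compl_iff _ _ (borel ℕ∞)).1
        (MeasurableSpace.measurableSet_generateFrom (isClosed_singleton (x := a)).isOpen_compl)
  refine Measurable.iSup fun n => ?_
  have h : (fun ω => ⨆ _ : jumpTime τ n ω ≤ s, (n : ℕ∞)) =
      Set.indicator {ω | jumpTime τ n ω ≤ s} fun _ => (n : ℕ∞) := by
    funext ω
    by_cases hω : jumpTime τ n ω ≤ s <;> simp [Set.indicator, hω]
  rw [h]
  exact measurable_const.indicator (measurableSet_le (measurable_jumpTime hτ n) measurable_const)

theorem measurable_proc {X : ℕ → Ω → E} {τ : ℕ → Ω → ℝ≥0} (hX : ∀ n, Measurable (X n))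
    (hτ : ∀ n, Measurable (τ n)) (s : ℝ≥0) : Measurable (proc X τ s) := by
  classical
  refine Measurable.ite ?_ (measurable_inl.comp ?_) measurable_const
  · have h : {ω | ∃ n, s < jumpTime τ n ω} = ⋃ n, {ω | s < jumpTime τ n ω} := by
      ext ω; simp
    rw [h]
    exact MeasurableSet.iUnion fun n => measurableSet_lt measurable_const (measurable_jumpTime hτ n)
  · have h : Measurable fun p : ℕ × Ω => X p.1 p.2 := measurable_from_prod_countable_right hX
    exact h.comp (((measurable_of_countable ENat.toNat).comp (measurable_numJumps hτ s)).prodMk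
      measurable_id)

/-- The natural filtration `ℱ_s = σ(Y_r : r ≤ s)` of the process `Y = proc X τ`. -/
def natFiltration {X : ℕ → Ω → E} {τ : ℕ → Ω → ℝ≥0} (hX : ∀ n, Measurable (X n))
    (hτ : ∀ n, Measurable (τ n)) : Filtration ℝ≥0 (inferInstance : MeasurableSpace Ω) where
  seq s := ⨆ r ≤ s, MeasurableSpace.comap (proc X τ r) inferInstance
  mono' _ _ h := biSup_mono fun _ hr => hr.trans h
  le' _ := iSup₂_le fun r _ => (measurable_proc hX hτ r).comap_le

/-- `M_s = f(Y_s) - f(x) - ∫₀ˢ h(Y_r) dr`. -/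
def mart (X : ℕ → Ω → E) (τ : ℕ → Ω → ℝ≥0) (f h : E → ℝ) (x : E) (s : ℝ≥0) (ω : Ω) : ℝ :=
  extend f (proc X τ s ω) - f x - ∫ r in (0 : ℝ)..s, extend h (proc X τ r.toNNReal ω)

/-- Under `P`, the path integrals `∫₀ˢ h(Y_r) dr` are a.s. all well defined, and `mart X τ f h x`
is a martingale with respect to the natural filtration of `Y`. -/
structure SolvesMartingale {X : ℕ → Ω → E} {τ : ℕ → Ω → ℝ≥0} (hX : ∀ n, Measurable (X n))
    (hτ : ∀ n, Measurable (τ n)) (P : Measure Ω) (f h : E → ℝ) (x : E) : Prop where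
  integrable : ∀ᵐ ω ∂P, ∀ s : ℝ≥0,
    IntervalIntegrable (fun r : ℝ => extend h (proc X τ r.toNNReal ω)) volume 0 s
  martingale : Martingale (mart X τ f h x) (natFiltration hX hτ) P

/-- The graph of the weak generator of `Y` under the family `(P x)_x` of laws: `f` is in the
domain, and `h` is a version of the weak generator applied to `f`, if for `π`-almost every start
`x` the process `f(Y_s) - f(x) - ∫₀ˢ h(Y_r) dr` is a martingale. -/
structure IsWeakGenerator {X : ℕ → Ω → E} {τ : ℕ → Ω → ℝ≥0} (hX : ∀ n, Measurable (X n))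
    (hτ : ∀ n, Measurable (τ n)) (π : Measure E) (P : E → Measure Ω) (f h : E → ℝ) : Prop where
  measurable_left : Measurable f
  measurable_right : Measurable h
  solves : ∀ᵐ x ∂π, SolvesMartingale hX hτ (P x) f h x

/-- The domain of the weak generator. -/
def weakDomain {X : ℕ → Ω → E} {τ : ℕ → Ω → ℝ≥0} (hX : ∀ n, Measurable (X n))
    (hτ : ∀ n, Measurable (τ n)) (π : Measure E) (P : E → Measure Ω) : Set (E → ℝ) :=
  {f | ∃ h, IsWeakGenerator hX hτ π P f h}

/-- The set `S` of starts in `supp(π)` with `λ(x) < ∞` from which the expected number of jumps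
in every bounded time interval is finite. -/
def goodStarts [TopologicalSpace E] (γ : Kernel E E) (t : E → E → ℝ≥0) (g : ℝ≥0 → ℝ≥0)
    (π : Measure E) (P : E → Measure Ω) (τ : ℕ → Ω → ℝ≥0) : Set E :=
  {x | x ∈ π.support ∧ rate γ t g x < ∞ ∧
    ∀ s : ℝ≥0, 0 < s → ∫⁻ ω, (numJumps τ s ω : ℝ≥0∞) ∂(P x) < ∞}

end JumpPaths

end

end LBMJP

/-! Almost every start is good because of reversibility. By $g(s)=s\,g(1/s)$ the measure
$\pi(dx)\gamma(x,dy)g(t(x,y))$ is symmetric (`lintegral_flow_swap`), so $\iint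
g(t(x,y))\varphi(y)\,\gamma(x,dy)\,\pi(dx)=\int\lambda\varphi\,d\pi$. Let $u_n(x,s)=\mathbb
P_x(T_n\le s)$. Conditioning on the first jump gives $u_{n+1}(x,s)+\lambda(x)\int_{-\infty}^s
u_{n+1}(x,a)\,da=\int g(t(x,y))\int_{-\infty}^s u_n(y,a)\,da\,\gamma(x,dy)$ (`jumpTail_succ_add`).
Integrated against $\pi$ this telescopes in $n$, so $\int\mathbb E_x[n_s]\,\pi(dx)=\sum_{n\ge1}\int
u_n\,d\pi\le s\,\pi(\lambda)$, and $\pi(\lambda)\le 2$ since $g(s)\le 1+s$ and $t$ has integral at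
most 1.

For the martingale property, $M_s$ is split into contributions `martIncr`, one for each sojourn
together with the jump that ends it. Given the first $k$ jumps, contribution $k$ is centred, because
$\lambda\,\mathbb E[\min(b,\tau)^+]=\mathbb P(\tau\le b)$ for $\tau\sim\mathrm{Exp}(\lambda)$. Its
$L^1$ norm is at most $4C\,\mathbb P(T_{k+1}\le s)$ if $|f|\le C$, which is summable when $\mathbb
E_x[n_s]<\infty$. An event of $\mathcal F_u$ agrees on $\{T_{k+1}>u\}$ with an event of the first
$k$ jumps (`natFiltration_le_pastEvents`), and on the complement contribution $k$ no longer changes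
after $u$.

For uniqueness, if $h$ and $h'$ both solve the problem at $x$, then $\int_0^s(h-h')(Y_r)\,dr$ is a
martingale. Stopped at the exit time $\rho\le1$ from $x$ it equals $(h-h')(x)\rho$, so
$(h-h')(x)\,\mathbb E[\rho]=0$ with $\mathbb E[\rho]>0$ (`eq_zero_of_martingale_integral`).
Conversely, $\pi$-null changes of $h$ are invisible, since a chain started outside a null set never
enters it (`ae_notMem_of_null`). -/

namespace LBMJP

/-! ### Measurability of the rates; the jump and holding laws as kernels -/

section JumpKernels

variable {E : Type*} [MeasurableSpace E] (γ : Kernel E E) {t : E → E → ℝ≥0} {g : ℝ≥0 → ℝ≥0}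

theorem measurable_rate [IsSFiniteKernel γ]
    (hgt : Measurable fun p : E × E => g (t p.1 p.2)) : Measurable (rate γ t g) :=
  Measurable.lintegral_kernel_prod_right' (κ := γ)
    (f := fun p : E × E => (g (t p.1 p.2) : ℝ≥0∞)) hgt.coe_nnreal_ennreal

theorem lintegral_jumpLaw
    (hgt : Measurable fun p : E × E => g (t p.1 p.2)) (x : E) {φ : E → ℝ≥0∞} (hφ : Measurable φ) :
    ∫⁻ y, φ y ∂(jumpLaw γ t g x) = ∫⁻ y, (g (t x y) : ℝ≥0∞) / rate γ t g x * φ y ∂(γ x) := by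
  rw [jumpLaw, lintegral_withDensity_eq_lintegral_mul _ _ hφ]
  · rfl
  · exact (hgt.comp measurable_prodMk_left).coe_nnreal_ennreal.div_const _

theorem jumpLaw_apply_univ
    (hgt : Measurable fun p : E × E => g (t p.1 p.2)) (x : E) :
    jumpLaw γ t g x Set.univ = rate γ t g x / rate γ t g x := by
  rw [jumpLaw, withDensity_apply _ MeasurableSet.univ, Measure.restrict_univ]
  simp only [div_eq_mul_inv]
  exact lintegral_mul_const _ (hgt.comp measurable_prodMk_left).coe_nnreal_ennreal

theorem measurable_jumpLaw [IsSFiniteKernel γ]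
    (hgt : Measurable fun p : E × E => g (t p.1 p.2)) : Measurable (jumpLaw γ t g) := by
  refine Measure.measurable_of_measurable_coe _ fun A hA => ?_
  have : (fun x => jumpLaw γ t g x A) = fun x =>
      ∫⁻ y, A.indicator (fun y => (g (t x y) : ℝ≥0∞) / rate γ t g x) y ∂(γ x) := by
    funext x
    rw [jumpLaw, withDensity_apply _ hA, lintegral_indicator hA]
  rw [this]
  refine Measurable.lintegral_kernel_prod_right' (κ := γ)
    (f := fun p : E × E => A.indicator (fun y => (g (t p.1 y) : ℝ≥0∞) / rate γ t g p.1) p.2) ?_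
  have h := (hgt.coe_nnreal_ennreal.div ((measurable_rate γ hgt).comp measurable_fst)).indicator
    (measurable_snd hA)
  exact h

theorem measurable_expMeasure : Measurable expMeasure := by
  refine Measure.measurable_of_measurable_coe _ fun A hA => ?_
  have : (fun r => expMeasure r A) = fun r => ∫⁻ y in A, exponentialPDF r y := by
    funext r
    rw [expMeasure, gammaMeasure, withDensity_apply _ hA]
    rfl
  rw [this]
  refine Measurable.lintegral_prod_right' (f := fun p : ℝ × ℝ => exponentialPDF p.1 p.2) ?_
  simp only [exponentialPDF_eq]
  refine (Measurable.ite (measurableSet_le measurable_const measurable_snd) ?_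
    measurable_const).ennreal_ofReal
  fun_prop

/-- Rates enter through `toReal`, so $\lambda(x)=\infty$ also leads to parameter 0. The holding
kernel is therefore only sub-Markov in general. -/
theorem expMeasure_zero : expMeasure 0 = 0 := by
  rw [expMeasure, gammaMeasure]
  have : gammaPDF 1 0 = 0 := by
    funext y
    simp [gammaPDF_eq]
  rw [this, withDensity_zero]

theorem expMeasure_univ_le {r : ℝ} (hr : 0 ≤ r) : expMeasure r Set.univ ≤ 1 := by
  rcases hr.eq_or_lt with rfl | hr
  · simp [expMeasure_zero]
  · have := isProbabilityMeasure_expMeasure hr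
    exact prob_le_one

/-- The kernel `Γ_g`. -/
noncomputable def jumpKernel [IsSFiniteKernel γ]
    (hgt : Measurable fun p : E × E => g (t p.1 p.2)) : Kernel E E :=
  ⟨jumpLaw γ t g, measurable_jumpLaw γ hgt⟩

/-- The law `Exp(λ(x))` of the holding time at `x`, as a kernel. -/
noncomputable def holdKernel [IsSFiniteKernel γ]
    (hgt : Measurable fun p : E × E => g (t p.1 p.2)) : Kernel E ℝ :=
  ⟨fun x => expMeasure (rate γ t g x).toReal,
    measurable_expMeasure.comp (measurable_rate γ hgt).ennreal_toReal⟩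

variable [IsSFiniteKernel γ] (hgt : Measurable fun p : E × E => g (t p.1 p.2))

instance : IsFiniteKernel (jumpKernel γ hgt) :=
  ⟨⟨1, ENNReal.one_lt_top, fun x => (jumpLaw_apply_univ γ hgt x).trans_le ENNReal.div_self_le_one⟩⟩

instance : IsFiniteKernel (holdKernel γ hgt) :=
  ⟨⟨1, ENNReal.one_lt_top, fun _ => expMeasure_univ_le ENNReal.toReal_nonneg⟩⟩

/-- The joint law `Γ_g(x, dy) Exp(λ(x))(dr)` of the next state and of the holding time. -/
noncomputable def stepKernel : Kernel E (E × ℝ) := jumpKernel γ hgt ×ₖ holdKernel γ hgt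

instance : IsFiniteKernel (stepKernel γ hgt) := by
  unfold stepKernel; infer_instance

theorem stepKernel_apply (x : E) : stepKernel γ hgt x =
    (jumpLaw γ t g x).prod (expMeasure (rate γ t g x).toReal) :=
  Kernel.prod_apply _ _ _

theorem stepKernel_apply_prod (x : E) (C : Set E) (D : Set ℝ) : stepKernel γ hgt x (C ×ˢ D) =
    jumpLaw γ t g x C * expMeasure (rate γ t g x).toReal D :=
  Kernel.prod_apply_prod

end JumpKernels

/-! ### σ-algebras generated by the first jumps -/

section Histories

variable {E Ω : Type*} [MeasurableSpace E]

/-- The cylinder events of the first `n` jumps. -/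
def cylinders (X : ℕ → Ω → E) (τ : ℕ → Ω → ℝ≥0) (n : ℕ) : Set (Set Ω) :=
  {S | ∃ (A : ℕ → Set E) (B : ℕ → Set ℝ), (∀ i, MeasurableSet (A i)) ∧ (∀ i, MeasurableSet (B i)) ∧
    S = {ω | (∀ i ≤ n, X i ω ∈ A i) ∧ ∀ i ∈ Finset.Icc 1 n, (τ i ω : ℝ) ∈ B i}}

/-- The σ-algebra generated by `X_0, ..., X_n, τ_1, ..., τ_n`. -/
abbrev history (X : ℕ → Ω → E) (τ : ℕ → Ω → ℝ≥0) (n : ℕ) : MeasurableSpace Ω :=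
  MeasurableSpace.generateFrom (cylinders X τ n)

theorem isPiSystem_cylinders (X : ℕ → Ω → E) (τ : ℕ → Ω → ℝ≥0) (n : ℕ) :
    IsPiSystem (cylinders X τ n) := by
  rintro _ ⟨A, B, hA, hB, rfl⟩ _ ⟨A', B', hA', hB', rfl⟩ -
  refine ⟨fun i => A i ∩ A' i, fun i => B i ∩ B' i, fun i => (hA i).inter (hA' i),
    fun i => (hB i).inter (hB' i), ?_⟩
  ext ω
  simp only [Set.mem_inter_iff, Set.mem_ofPred_eq]
  grind

theorem measurable_history_state (X : ℕ → Ω → E) (τ : ℕ → Ω → ℝ≥0) {i n : ℕ} (hi : i ≤ n) :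
    Measurable[history X τ n] (X i) := by
  classical
  intro C hC
  refine MeasurableSpace.measurableSet_generateFrom
    ⟨fun j => if j = i then C else Set.univ, fun _ => Set.univ, fun j => ?_, fun _ => .univ, ?_⟩
  · dsimp only
    split_ifs
    exacts [hC, .univ]
  · ext ω
    simp only [Set.mem_preimage, Set.mem_ofPred_eq, Set.mem_univ, implies_true, and_true]
    refine ⟨fun h j _ => ?_, fun h => by simpa using h i hi⟩
    split_ifs with hj
    exacts [hj ▸ h, trivial]

theorem measurable_history_hold (X : ℕ → Ω → E) (τ : ℕ → Ω → ℝ≥0) {i n : ℕ}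
    (hi : i ∈ Finset.Icc 1 n) : Measurable[history X τ n] (τ i) := by
  classical
  have key : Measurable[history X τ n] fun ω => (τ i ω : ℝ) := by
    intro C hC
    refine MeasurableSpace.measurableSet_generateFrom
      ⟨fun _ => Set.univ, fun j => if j = i then C else Set.univ, fun _ => .univ, fun j => ?_, ?_⟩
    · dsimp only
      split_ifs
      exacts [hC, .univ]
    · ext ω
      simp only [Set.mem_preimage, Set.mem_ofPred_eq, Set.mem_univ, implies_true, true_and]
      refine ⟨fun h j _ => ?_, fun h => by simpa using h i hi⟩
      split_ifs with hj
      exacts [hj ▸ h, trivial]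
  have := key.real_toNNReal
  simpa using this

theorem measurable_history_jumpTime (X : ℕ → Ω → E) (τ : ℕ → Ω → ℝ≥0) {i n : ℕ} (hi : i ≤ n) :
    Measurable[history X τ n] (jumpTime τ i) :=
  @Finset.measurable_fun_sum _ _ _ _ _ _ (history X τ n) _ (Finset.range i) fun k hk =>
    measurable_history_hold X τ (by simp at hk ⊢; omega)

theorem history_le [MeasurableSpace Ω] {X : ℕ → Ω → E} {τ : ℕ → Ω → ℝ≥0}
    (hX : ∀ n, Measurable (X n)) (hτ : ∀ n, Measurable (τ n)) (n : ℕ) : history X τ n ≤ ‹MeasurableSpace Ω› := by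
  refine MeasurableSpace.generateFrom_le ?_
  rintro _ ⟨A, B, hA, hB, rfl⟩
  simp only [Set.ofPred_and, Set.ofPred_forall]
  exact (MeasurableSet.iInter fun i => .iInter fun _ => hX i (hA i)).inter
    (MeasurableSet.iInter fun i => .iInter fun _ => (hτ i).coe_nnreal_real (hB i))

/-- The cylinder events of the first `n` states. -/
def stateCylinders (X : ℕ → Ω → E) (n : ℕ) : Set (Set Ω) :=
  {S | ∃ A : ℕ → Set E, (∀ i, MeasurableSet (A i)) ∧ S = {ω | ∀ i ≤ n, X i ω ∈ A i}}

/-- The σ-algebra generated by `X_0, ..., X_n`. -/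
abbrev stateHistory (X : ℕ → Ω → E) (n : ℕ) : MeasurableSpace Ω :=
  MeasurableSpace.generateFrom (stateCylinders X n)

theorem isPiSystem_stateCylinders (X : ℕ → Ω → E) (n : ℕ) : IsPiSystem (stateCylinders X n) := by
  rintro _ ⟨A, hA, rfl⟩ _ ⟨A', hA', rfl⟩ -
  refine ⟨fun i => A i ∩ A' i, fun i => (hA i).inter (hA' i), ?_⟩
  ext ω
  simp only [Set.mem_inter_iff, Set.mem_ofPred_eq]
  grind

theorem measurable_stateHistory (X : ℕ → Ω → E) {i n : ℕ} (hi : i ≤ n) :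
    Measurable[stateHistory X n] (X i) := by
  classical
  intro C hC
  refine MeasurableSpace.measurableSet_generateFrom
    ⟨fun j => if j = i then C else Set.univ, fun j => ?_, ?_⟩
  · dsimp only
    split_ifs
    exacts [hC, .univ]
  · ext ω
    simp only [Set.mem_preimage, Set.mem_ofPred_eq]
    refine ⟨fun h j _ => ?_, fun h => by simpa using h i hi⟩
    split_ifs with hj
    exacts [hj ▸ h, trivial]

theorem stateHistory_le [MeasurableSpace Ω] {X : ℕ → Ω → E} (hX : ∀ n, Measurable (X n)) (n : ℕ) :
    stateHistory X n ≤ ‹MeasurableSpace Ω› := by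
  refine MeasurableSpace.generateFrom_le ?_
  rintro _ ⟨A, hA, rfl⟩
  simp only [Set.ofPred_forall]
  exact MeasurableSet.iInter fun i => .iInter fun _ => hX i (hA i)

/-- Two finite measures that agree on a `π`-system have the same integrals of functions that are
measurable with respect to the σ-algebra it generates. -/
theorem lintegral_eq_of_generateFrom {m0 : MeasurableSpace Ω} {μ ν : Measure Ω} [IsFiniteMeasure μ]
    {C : Set (Set Ω)} (hC : IsPiSystem C) (hle : MeasurableSpace.generateFrom C ≤ m0)
    (huniv : Set.univ ∈ C) (h : ∀ s ∈ C, μ s = ν s) {f : Ω → ℝ≥0∞}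
    (hf : Measurable[MeasurableSpace.generateFrom C] f) : ∫⁻ ω, f ω ∂μ = ∫⁻ ω, f ω ∂ν := by
  rw [← lintegral_trim hle hf, ← lintegral_trim hle hf]
  congr 1
  have : ∀ s ∈ C, μ.trim hle s = ν.trim hle s := fun s hs => by
    rw [trim_measurableSet_eq hle (MeasurableSpace.measurableSet_generateFrom hs),
      trim_measurableSet_eq hle (MeasurableSpace.measurableSet_generateFrom hs), h s hs]
  exact @ext_of_generate_finite _ (MeasurableSpace.generateFrom C) _ _ _ rfl hC
    (isFiniteMeasure_trim hle) this (this _ huniv)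

end Histories

/-! ### The Markov property at jump times -/

section OneStep

variable {E Ω : Type*} [MeasurableSpace E] [mΩ : MeasurableSpace Ω] {γ : Kernel E E}
  [IsSFiniteKernel γ] {t : E → E → ℝ≥0} {g : ℝ≥0 → ℝ≥0}
  (hgt : Measurable fun p : E × E => g (t p.1 p.2)) {x : E} {P : Measure Ω} {X : ℕ → Ω → E}
  {τ : ℕ → Ω → ℝ≥0} (hX : ∀ n, Measurable (X n)) (hτ : ∀ n, Measurable (τ n))
  (hY : IsLBMJP γ t g x P X τ)
include hgt hX hY

/-- Monotone-class extension of `chain` from cylinders to functions of $X_0,\dots,X_n$; this is what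
allows $X_{n+1}$ to be integrated out. -/
theorem IsLBMJP.setLIntegral_chain (n : ℕ) {C : Set E} (hC : MeasurableSet C) {f : Ω → ℝ≥0∞}
    (hf : Measurable[stateHistory X n] f) :
    ∫⁻ ω in X (n + 1) ⁻¹' C, f ω ∂P = ∫⁻ ω, f ω * jumpLaw γ t g (X n ω) C ∂P := by
  have := hY.prob
  have hd : Measurable fun ω => jumpLaw γ t g (X n ω) C :=
    ((Measure.measurable_coe hC).comp (measurable_jumpLaw γ hgt)).comp (hX n)
  have hle := stateHistory_le hX n
  have key : ∫⁻ ω, f ω ∂(P.restrict (X (n + 1) ⁻¹' C)) =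
      ∫⁻ ω, f ω ∂(P.withDensity fun ω => jumpLaw γ t g (X n ω) C) := by
    refine lintegral_eq_of_generateFrom (isPiSystem_stateCylinders X n) hle
      ⟨fun _ => Set.univ, fun _ => .univ, by simp⟩ ?_ hf
    rintro _ ⟨A, hA, rfl⟩
    have hm : MeasurableSet {ω | ∀ i ≤ n, X i ω ∈ A i} :=
      hle _ (MeasurableSpace.measurableSet_generateFrom ⟨A, hA, rfl⟩)
    rw [Measure.restrict_apply hm, withDensity_apply _ hm, ← hY.chain n A C hA hC]
    rfl
  rw [key, lintegral_withDensity_eq_lintegral_mul _ hd (hf.mono hle le_rfl)]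
  exact lintegral_congr fun ω => mul_comm _ _

theorem IsLBMJP.setLIntegral_holding (n : ℕ) {B : ℕ → Set ℝ} (hB : ∀ i, MeasurableSet (B i))
    {f : Ω → ℝ≥0∞} (hf : Measurable[stateHistory X n] f) :
    ∫⁻ ω in {ω | ∀ i ∈ Finset.Icc 1 n, (τ i ω : ℝ) ∈ B i}, f ω ∂P =
      ∫⁻ ω, f ω *
        ∏ i ∈ Finset.Icc 1 n, expMeasure (rate γ t g (X (i - 1) ω)).toReal (B i) ∂P := by
  have := hY.prob
  have hd : Measurable fun ω =>
      ∏ i ∈ Finset.Icc 1 n, expMeasure (rate γ t g (X (i - 1) ω)).toReal (B i) :=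
    Finset.measurable_fun_prod _ fun i _ => (((Measure.measurable_coe (hB i)).comp
      measurable_expMeasure).comp (measurable_rate γ hgt).ennreal_toReal).comp (hX _)
  have hle := stateHistory_le hX n
  have key : ∫⁻ ω, f ω ∂(P.restrict {ω | ∀ i ∈ Finset.Icc 1 n, (τ i ω : ℝ) ∈ B i}) =
      ∫⁻ ω, f ω ∂(P.withDensity fun ω =>
        ∏ i ∈ Finset.Icc 1 n, expMeasure (rate γ t g (X (i - 1) ω)).toReal (B i)) := by
    refine lintegral_eq_of_generateFrom (isPiSystem_stateCylinders X n) hle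
      ⟨fun _ => Set.univ, fun _ => .univ, by simp⟩ ?_ hf
    rintro _ ⟨A, hA, rfl⟩
    have hm : MeasurableSet {ω | ∀ i ≤ n, X i ω ∈ A i} :=
      hle _ (MeasurableSpace.measurableSet_generateFrom ⟨A, hA, rfl⟩)
    rw [Measure.restrict_apply hm, withDensity_apply _ hm, ← hY.holding n A B hA hB]
    rfl
  rw [key, lintegral_withDensity_eq_lintegral_mul _ hd (hf.mono hle le_rfl)]
  exact lintegral_congr fun ω => mul_comm _ _

include hτ

/-- The rate of $\tau_{n+1}$ depends on $X_n$ and not on $X_{n+1}$. So after `holding` at level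
$n+1$ the state $X_{n+1}$ can be integrated out by `chain`, and `holding` at level $n$, read
backwards, turns the remaining product of exponential masses into the event on
$\tau_1,\dots,\tau_n$. -/
theorem IsLBMJP.measure_cylinder_step (n : ℕ) {S : Set Ω} (hS : S ∈ cylinders X τ n) {C : Set E}
    (hC : MeasurableSet C) {D : Set ℝ} (hD : MeasurableSet D) :
    P (S ∩ {ω | X (n + 1) ω ∈ C ∧ (τ (n + 1) ω : ℝ) ∈ D}) =
      ∫⁻ ω in S, jumpLaw γ t g (X n ω) C * expMeasure (rate γ t g (X n ω)).toReal D ∂P := by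
  classical
  obtain ⟨A, B, hA, hB, rfl⟩ := hS
  set S₁ : Set Ω := {ω | ∀ i ≤ n, X i ω ∈ A i} with hS₁
  have hS₁m : MeasurableSet[stateHistory X n] S₁ :=
    MeasurableSpace.measurableSet_generateFrom ⟨A, hA, rfl⟩
  have hS₁m' : MeasurableSet S₁ := stateHistory_le hX n _ hS₁m
  set S₂ : Set Ω := {ω | ∀ i ∈ Finset.Icc 1 n, (τ i ω : ℝ) ∈ B i} with hS₂
  have hS₂m : MeasurableSet S₂ := by
    simp only [hS₂, Set.ofPred_forall]
    exact MeasurableSet.iInter fun i => .iInter fun _ => (hτ i).coe_nnreal_real (hB i)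
  have hexp : ∀ {D : Set ℝ}, MeasurableSet D →
      Measurable fun y => expMeasure (rate γ t g y).toReal D := fun hD =>
    ((Measure.measurable_coe hD).comp measurable_expMeasure).comp
      (measurable_rate γ hgt).ennreal_toReal
  have hjump : Measurable fun y => jumpLaw γ t g y C :=
    (Measure.measurable_coe hC).comp (measurable_jumpLaw γ hgt)
  set prodB : Ω → ℝ≥0∞ := fun ω =>
    ∏ i ∈ Finset.Icc 1 n, expMeasure (rate γ t g (X (i - 1) ω)).toReal (B i) with hprodB
  have hprodBm : Measurable[stateHistory X n] prodB :=
    Finset.measurable_fun_prod _ fun i hi =>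
      (hexp (hB i)).comp (measurable_stateHistory X (by have := Finset.mem_Icc.1 hi; omega))
  have hlast : Measurable[stateHistory X n]
      fun ω => expMeasure (rate γ t g (X n ω)).toReal D :=
    (hexp hD).comp (measurable_stateHistory X le_rfl)
  have hlastj : Measurable[stateHistory X n] fun ω => jumpLaw γ t g (X n ω) C :=
    hjump.comp (measurable_stateHistory X le_rfl)
  have h1 := hY.holding (n + 1) (fun i => if i = n + 1 then C else A i)
    (fun i => if i = n + 1 then D else B i)
    (fun i => by split_ifs; exacts [hC, hA i])
    (fun i => by split_ifs; exacts [hD, hB i])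
  have e1 : {ω | (∀ i ≤ n + 1, X i ω ∈ if i = n + 1 then C else A i) ∧
      ∀ i ∈ Finset.Icc 1 (n + 1), (τ i ω : ℝ) ∈ if i = n + 1 then D else B i} =
      {ω | (∀ i ≤ n, X i ω ∈ A i) ∧ ∀ i ∈ Finset.Icc 1 n, (τ i ω : ℝ) ∈ B i} ∩
        {ω | X (n + 1) ω ∈ C ∧ (τ (n + 1) ω : ℝ) ∈ D} := by
    ext ω
    simp only [Set.mem_inter_iff, Set.mem_ofPred_eq, Finset.mem_Icc]
    grind
  have e2 : {ω | ∀ i ≤ n + 1, X i ω ∈ if i = n + 1 then C else A i} = S₁ ∩ X (n + 1) ⁻¹' C := by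
    ext ω
    simp only [hS₁, Set.mem_inter_iff, Set.mem_ofPred_eq, Set.mem_preimage]
    grind
  have e3 : ∀ ω, (∏ i ∈ Finset.Icc 1 (n + 1), expMeasure (rate γ t g (X (i - 1) ω)).toReal
      (if i = n + 1 then D else B i)) =
        prodB ω * expMeasure (rate γ t g (X n ω)).toReal D := by
    intro ω
    rw [Finset.prod_Icc_succ_top (by omega)]
    simp only [hprodB, Nat.add_sub_cancel, if_true]
    congr 1
    refine Finset.prod_congr rfl fun i hi => ?_
    rw [if_neg (by simp at hi; omega)]
  rw [e1, e2] at h1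
  rw [h1]
  simp only [e3]
  have hXC : MeasurableSet (X (n + 1) ⁻¹' C) := hX _ hC
  calc ∫⁻ ω in S₁ ∩ X (n + 1) ⁻¹' C, prodB ω * expMeasure (rate γ t g (X n ω)).toReal D ∂P
      = ∫⁻ ω in X (n + 1) ⁻¹' C, S₁.indicator
          (fun ω => prodB ω * expMeasure (rate γ t g (X n ω)).toReal D) ω ∂P := by
        rw [lintegral_indicator hS₁m', Measure.restrict_restrict hS₁m']
    _ = ∫⁻ ω, S₁.indicator (fun ω => prodB ω * expMeasure (rate γ t g (X n ω)).toReal D) ω *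
          jumpLaw γ t g (X n ω) C ∂P :=
        hY.setLIntegral_chain hgt hX n hC ((hprodBm.mul hlast).indicator hS₁m)
    _ = ∫⁻ ω, S₁.indicator (fun ω => jumpLaw γ t g (X n ω) C *
          expMeasure (rate γ t g (X n ω)).toReal D) ω * prodB ω ∂P := by
        refine lintegral_congr fun ω => ?_
        by_cases hω : ω ∈ S₁
        · simp only [Set.indicator_of_mem hω]; ring
        · simp [Set.indicator_of_notMem hω]
    _ = ∫⁻ ω in S₂, S₁.indicator (fun ω => jumpLaw γ t g (X n ω) C *
          expMeasure (rate γ t g (X n ω)).toReal D) ω ∂P :=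
        (hY.setLIntegral_holding hgt hX n hB ((hlastj.mul hlast).indicator hS₁m)).symm
    _ = _ := by
        rw [lintegral_indicator hS₁m', Measure.restrict_restrict hS₁m']
        rfl

/-- The Markov property at the jump times: given the first `n` jumps, the pair
`(X_{n+1}, τ_{n+1})` has the law `Γ_g(X_n, dy) Exp(λ(X_n))(dr)`. -/
theorem IsLBMJP.map_step (n : ℕ) {B : Set Ω} (hB : MeasurableSet[history X τ n] B) :
    (P.restrict B).map (fun ω => ((X n ω, (jumpTime τ n ω : ℝ)),
        (X (n + 1) ω, (τ (n + 1) ω : ℝ)))) =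
      ((P.restrict B).map fun ω => (X n ω, (jumpTime τ n ω : ℝ))) ⊗ₘ
        (stepKernel γ hgt).comap Prod.fst measurable_fst := by
  have := hY.prob
  have hle := history_le hX hτ n
  have hT : Measurable fun ω => (jumpTime τ n ω : ℝ) :=
    (measurable_jumpTime hτ n).coe_nnreal_real
  have hZ : Measurable fun ω => (X (n + 1) ω, (τ (n + 1) ω : ℝ)) :=
    (hX _).prodMk (hτ _).coe_nnreal_real
  have hW : Measurable fun ω => (X n ω, (jumpTime τ n ω : ℝ)) := (hX _).prodMk hT
  refine Measure.ext_prod₃ fun {s C D} hs hC hD => ?_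
  rw [Measure.map_apply (hW.prodMk hZ) (hs.prod (hC.prod hD)),
    Measure.compProd_apply_prod hs (hC.prod hD), setLIntegral_map hs
      (Kernel.measurable_coe _ (hC.prod hD)) hW]
  simp only [Kernel.comap_apply, stepKernel_apply_prod]
  set W : Ω → E × ℝ := fun ω => (X n ω, (jumpTime τ n ω : ℝ)) with hWdef
  set U : Set Ω := {ω | X (n + 1) ω ∈ C ∧ (τ (n + 1) ω : ℝ) ∈ D} with hU
  have hUm : MeasurableSet U := hZ (hC.prod hD)
  have hWh : Measurable[history X τ n] W :=
    (measurable_history_state X τ le_rfl).prodMk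
      (measurable_history_jumpTime X τ le_rfl).coe_nnreal_real
  have hBW : MeasurableSet[history X τ n] (B ∩ W ⁻¹' s) := hB.inter (hWh hs)
  have hd : Measurable fun ω =>
      jumpLaw γ t g (X n ω) C * expMeasure (rate γ t g (X n ω)).toReal D :=
    (((Measure.measurable_coe hC).comp (measurable_jumpLaw γ hgt)).comp (hX n)).mul
      (((Measure.measurable_coe hD).comp measurable_expMeasure).comp
        ((measurable_rate γ hgt).ennreal_toReal.comp (hX n)))
  have key := lintegral_eq_of_generateFrom (μ := P.restrict U) (ν := P.withDensity fun ω =>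
    jumpLaw γ t g (X n ω) C * expMeasure (rate γ t g (X n ω)).toReal D)
    (isPiSystem_cylinders X τ n) hle
    ⟨fun _ => Set.univ, fun _ => Set.univ, fun _ => .univ, fun _ => .univ, by simp⟩ (by
      intro S hS
      have hm := hle _ (MeasurableSpace.measurableSet_generateFrom hS)
      rw [Measure.restrict_apply hm, withDensity_apply _ hm]
      exact hY.measure_cylinder_step hgt hX hτ n hS hC hD)
    (f := (B ∩ W ⁻¹' s).indicator 1) (measurable_const.indicator hBW)
  have hBW' := hle _ hBW
  rw [lintegral_indicator_one hBW', lintegral_indicator_one hBW', Measure.restrict_apply hBW',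
    withDensity_apply _ hBW'] at key
  have hBm := hle _ hB
  rw [Measure.restrict_apply ((hW.prodMk hZ) (hs.prod (hC.prod hD))),
    Measure.restrict_restrict (hW hs), Set.inter_comm (W ⁻¹' s) B, ← key]
  congr 1
  ext ω
  simp only [Set.mem_inter_iff, Set.mem_preimage, Set.mem_prod, hU, hWdef, Set.mem_ofPred_eq]
  tauto

theorem IsLBMJP.setLIntegral_step (n : ℕ) {B : Set Ω} (hB : MeasurableSet[history X τ n] B)
    {φ : (E × ℝ) × (E × ℝ) → ℝ≥0∞} (hφ : Measurable φ) :
    ∫⁻ ω in B, φ ((X n ω, (jumpTime τ n ω : ℝ)), (X (n + 1) ω, (τ (n + 1) ω : ℝ))) ∂P =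
      ∫⁻ ω in B, ∫⁻ z, φ ((X n ω, (jumpTime τ n ω : ℝ)), z) ∂(stepKernel γ hgt (X n ω)) ∂P := by
  have := hY.prob
  have hT : Measurable fun ω => (jumpTime τ n ω : ℝ) :=
    (measurable_jumpTime hτ n).coe_nnreal_real
  have hZ : Measurable fun ω => (X (n + 1) ω, (τ (n + 1) ω : ℝ)) :=
    (hX _).prodMk (hτ _).coe_nnreal_real
  have hW : Measurable fun ω => (X n ω, (jumpTime τ n ω : ℝ)) := (hX _).prodMk hT
  rw [← lintegral_map (f := φ) hφ (hW.prodMk hZ), hY.map_step hgt hX hτ n hB,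
    Measure.lintegral_compProd hφ, lintegral_map hφ.lintegral_kernel_prod_right' hW]
  rfl

end OneStep

/-! ### Path properties: jump counts and time integrals -/

section Paths

variable {E Ω : Type*} {X : ℕ → Ω → E} {τ : ℕ → Ω → ℝ≥0} {ω : Ω} {s : ℝ≥0}

theorem jumpTime_zero (τ : ℕ → Ω → ℝ≥0) (ω : Ω) : jumpTime τ 0 ω = 0 := by simp [jumpTime]

theorem jumpTime_succ (τ : ℕ → Ω → ℝ≥0) (n : ℕ) (ω : Ω) :
    jumpTime τ (n + 1) ω = jumpTime τ n ω + τ (n + 1) ω := Finset.sum_range_succ _ _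

theorem monotone_jumpTime (τ : ℕ → Ω → ℝ≥0) (ω : Ω) : Monotone fun n => jumpTime τ n ω :=
  monotone_nat_of_le_succ fun n => by simp [jumpTime_succ]

theorem exists_jumpTime_le_lt {m : ℕ} (h : s < jumpTime τ m ω) :
    ∃ N < m, jumpTime τ N ω ≤ s ∧ s < jumpTime τ (N + 1) ω := by
  classical
  have hex : ∃ n, s < jumpTime τ n ω := ⟨m, h⟩
  obtain ⟨N, hN⟩ : ∃ N, Nat.find hex = N + 1 := by
    refine Nat.exists_eq_succ_of_ne_zero fun h0 => ?_
    have := Nat.find_spec hex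
    rw [h0, jumpTime_zero] at this
    exact not_lt_zero this
  refine ⟨N, ?_, not_lt.1 (Nat.find_min hex (by omega)), hN ▸ Nat.find_spec hex⟩
  have := Nat.find_min' hex h
  omega

theorem numJumps_eq {N : ℕ} (h1 : jumpTime τ N ω ≤ s) (h2 : s < jumpTime τ (N + 1) ω) :
    numJumps τ s ω = N := by
  refine le_antisymm (iSup₂_le fun n hn => ?_) (le_iSup₂_of_le N h1 le_rfl)
  have : n < N + 1 := by
    by_contra hc
    exact absurd (h2.trans_le (monotone_jumpTime τ ω (not_lt.1 hc))) (not_lt.2 hn)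
  exact_mod_cast Nat.lt_succ_iff.1 this

theorem proc_eq {N : ℕ} (h1 : jumpTime τ N ω ≤ s) (h2 : s < jumpTime τ (N + 1) ω) :
    proc X τ s ω = Sum.inl (X N ω) := by
  rw [proc, if_pos ⟨N + 1, h2⟩, numJumps_eq h1 h2, ENat.toNat_natCast]

/-- Reduces expected jump counts to the tails $\mathbb P(T_{n+1}\le s)$; after an explosion both
sides are infinite. -/
theorem coe_numJumps_eq_tsum (τ : ℕ → Ω → ℝ≥0) (s : ℝ≥0) (ω : Ω) :
    (numJumps τ s ω : ℝ≥0∞) =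
      ∑' n, {ω | jumpTime τ (n + 1) ω ≤ s}.indicator (fun _ => (1 : ℝ≥0∞)) ω := by
  classical
  by_cases h : ∃ m, s < jumpTime τ m ω
  · obtain ⟨m, hm⟩ := h
    obtain ⟨N, -, h1, h2⟩ := exists_jumpTime_le_lt hm
    rw [numJumps_eq h1 h2, tsum_eq_sum (s := Finset.range N)]
    · rw [Finset.sum_congr rfl (g := fun _ => (1 : ℝ≥0∞))]
      · simp
      · intro n hn
        have hle : n + 1 ≤ N := Finset.mem_range.1 hn
        exact Set.indicator_of_mem (s := {ω | jumpTime τ (n + 1) ω ≤ s})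
          ((monotone_jumpTime τ ω hle).trans h1) _
    · intro n hn
      refine Set.indicator_of_notMem (fun hc => ?_) _
      have hle : N + 1 ≤ n + 1 := by simpa using hn
      exact absurd (h2.trans_le (monotone_jumpTime τ ω hle)) (not_lt.2 hc)
  · push Not at h
    have h1 : numJumps τ s ω = ⊤ := by
      rw [ENat.eq_top_iff_forall_ge]
      exact fun n => le_iSup₂_of_le n (h n) le_rfl
    have h2 : ∀ n, {ω | jumpTime τ (n + 1) ω ≤ s}.indicator (fun _ => (1 : ℝ≥0∞)) ω = 1 :=
      fun n => Set.indicator_of_mem (s := {ω | jumpTime τ (n + 1) ω ≤ s}) (h (n + 1)) _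
    rw [h1, tsum_congr h2, ENNReal.tsum_const]
    simp

theorem exists_lt_jumpTime_of_numJumps_ne_top (h : numJumps τ s ω ≠ ⊤) :
    ∃ m, s < jumpTime τ m ω := by
  by_contra hc
  push Not at hc
  refine h ?_
  rw [ENat.eq_top_iff_forall_ge]
  exact fun n => le_iSup₂_of_le n (hc n) le_rfl

/-- The paths of the jump process are right-continuous, even for the discrete topology. -/
theorem exists_proc_eq_on_Ico (X : ℕ → Ω → E) (τ : ℕ → Ω → ℝ≥0) (ω : Ω) (s : ℝ≥0) :
    ∃ b, s < b ∧ ∀ r, s ≤ r → r < b → proc X τ r ω = proc X τ s ω := by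
  by_cases h : ∃ m, s < jumpTime τ m ω
  · obtain ⟨m, hm⟩ := h
    obtain ⟨N, -, h1, h2⟩ := exists_jumpTime_le_lt hm
    exact ⟨_, h2, fun r hr hr' => by rw [proc_eq h1 h2, proc_eq (h1.trans hr) hr']⟩
  · refine ⟨s + 1, by simp, fun r hr _ => ?_⟩
    rw [proc, proc, if_neg h, if_neg]
    exact fun ⟨m, hm⟩ => h ⟨m, hr.trans_lt hm⟩

theorem extend_proc_eq_sum (X : ℕ → Ω → E) (f : E → ℝ) {m : ℕ} (h : s < jumpTime τ m ω) :
    extend f (proc X τ s ω) = ∑ k ∈ Finset.range m,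
      (Set.Ico (jumpTime τ k ω : ℝ) (jumpTime τ (k + 1) ω)).indicator (fun _ => f (X k ω)) s := by
  obtain ⟨N, hN, h1, h2⟩ := exists_jumpTime_le_lt h
  rw [proc_eq h1 h2, Finset.sum_eq_single_of_mem N (Finset.mem_range.2 hN)]
  · rw [Set.indicator_of_mem (Set.mem_Ico.2 (by exact_mod_cast And.intro h1 h2))]
    rfl
  · intro k _ hk
    refine Set.indicator_of_notMem (fun hc => hk ?_) _
    have hc' : jumpTime τ k ω ≤ s ∧ s < jumpTime τ (k + 1) ω := by exact_mod_cast hc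
    exact_mod_cast (numJumps_eq hc'.1 hc'.2).symm.trans (numJumps_eq h1 h2)

theorem extend_proc_eqOn_sum (X : ℕ → Ω → E) (f : E → ℝ) {m : ℕ} (h : s < jumpTime τ m ω) :
    Set.EqOn (fun r : ℝ => extend f (proc X τ r.toNNReal ω)) (fun r => ∑ k ∈ Finset.range m,
      (Set.Ico (jumpTime τ k ω : ℝ) (jumpTime τ (k + 1) ω)).indicator (fun _ => f (X k ω)) r)
      (Set.Ioc 0 (s : ℝ)) := by
  intro r hr
  have hr' : r.toNNReal < jumpTime τ m ω :=
    (Real.toNNReal_le_iff_le_coe.2 hr.2).trans_lt h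
  have := extend_proc_eq_sum X f hr'
  rwa [Real.coe_toNNReal r hr.1.le] at this

theorem intervalIntegrable_extend_proc (X : ℕ → Ω → E) (f : E → ℝ) {m : ℕ}
    (h : s < jumpTime τ m ω) :
    IntervalIntegrable (fun r : ℝ => extend f (proc X τ r.toNNReal ω)) volume 0 s := by
  rw [intervalIntegrable_iff_integrableOn_Ioc_of_le s.coe_nonneg]
  refine IntegrableOn.congr_fun ?_ (extend_proc_eqOn_sum X f h).symm measurableSet_Ioc
  refine integrable_finsetSum _ fun k _ => ?_
  exact (integrable_const _).indicator measurableSet_Ico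

/-- The subtraction is truncated in `ℝ≥0`, so sojourns that begin after $s$ contribute zero and any
$m$ with $s<T_m$ may bound the sum. -/
theorem integral_extend_proc (X : ℕ → Ω → E) (f : E → ℝ) {m : ℕ} (h : s < jumpTime τ m ω) :
    ∫ r in (0 : ℝ)..s, extend f (proc X τ r.toNNReal ω) =
      ∑ k ∈ Finset.range m,
        f (X k ω) * (min s (jumpTime τ (k + 1) ω) - jumpTime τ k ω : ℝ≥0) := by
  rw [intervalIntegral.integral_of_le s.coe_nonneg,
    setIntegral_congr_fun measurableSet_Ioc (extend_proc_eqOn_sum X f h), integral_finsetSum]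
  · refine Finset.sum_congr rfl fun k _ => ?_
    rw [integral_indicator measurableSet_Ico, Measure.restrict_restrict measurableSet_Ico,
      setIntegral_const, smul_eq_mul, mul_comm]
    congr 1
    have : (Set.Ico (jumpTime τ k ω : ℝ) (jumpTime τ (k + 1) ω) ∩ Set.Ioc 0 (s : ℝ) : Set ℝ)
        =ᵐ[volume] Set.Ioc (jumpTime τ k ω : ℝ) (min s (jumpTime τ (k + 1) ω) : ℝ≥0) := by
      refine (Ico_ae_eq_Ioc.inter (ae_eq_refl _)).trans ?_
      rw [Set.Ioc_inter_Ioc, NNReal.coe_min, max_eq_left (NNReal.coe_nonneg _), min_comm]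
      exact ae_eq_refl _
    rw [measureReal_congr this, Real.volume_real_Ioc, NNReal.coe_sub_def]
  · intro k _
    exact (integrable_const _).indicator measurableSet_Ico

end Paths

/-! ### Renewal identity for the exponential law -/

section ExpMeasure

theorem expMeasure_Iic {r : ℝ} (hr : 0 < r) (x : ℝ) :
    expMeasure r (Set.Iic x) = ENNReal.ofReal (if 0 ≤ x then 1 - Real.exp (-(r * x)) else 0) := by
  have := isProbabilityMeasure_expMeasure hr
  rw [← ofReal_cdf, cdf_expMeasure_eq hr]

theorem exponentialPDF_add_mul_expMeasure_Iic {r : ℝ} (hr : 0 < r) (x : ℝ) :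
    exponentialPDF r x + ENNReal.ofReal r * expMeasure r (Set.Iic x) =
      ENNReal.ofReal r * (Set.Ici 0).indicator 1 x := by
  rw [expMeasure_Iic hr, exponentialPDF_eq]
  by_cases hx : 0 ≤ x
  · have hexp : Real.exp (-(r * x)) ≤ 1 := Real.exp_le_one_iff.2 (by nlinarith)
    rw [if_pos hx, if_pos hx, Set.indicator_of_mem (Set.mem_Ici.2 hx), ← ENNReal.ofReal_mul hr.le,
      ← ENNReal.ofReal_add (by positivity) (mul_nonneg hr.le (by linarith))]
    simp only [Pi.one_apply, mul_one]
    congr 1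
    ring
  · rw [if_neg hx, if_neg hx, Set.indicator_of_notMem (by simpa using hx)]
    simp

theorem measurable_exponentialPDF (r : ℝ) : Measurable (exponentialPDF r) :=
  (measurable_exponentialPDFReal r).ennreal_ofReal

theorem lintegral_expMeasure {r : ℝ} {φ : ℝ → ℝ≥0∞} (hφ : Measurable φ) :
    ∫⁻ q, φ q ∂(expMeasure r) = ∫⁻ q, exponentialPDF r q * φ q := by
  rw [expMeasure, gammaMeasure,
    lintegral_withDensity_eq_lintegral_mul _ 
      (show Measurable (gammaPDF 1 r) from measurable_exponentialPDF r) hφ]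
  rfl

/-- The renewal equation in integrated form. -/
theorem lintegral_expMeasure_sub_add {r : ℝ} (hr : 0 < r) {G : ℝ → ℝ≥0∞} (hG : Measurable G)
    (s : ℝ) :
    ∫⁻ q, G (s - q) ∂(expMeasure r) +
        ENNReal.ofReal r * ∫⁻ a in Set.Iic s, ∫⁻ q, G (a - q) ∂(expMeasure r) =
      ENNReal.ofReal r * ∫⁻ a in Set.Iic s, G a := by
  have hm := measurable_exponentialPDF r
  -- Both terms become integrals against $G(b)\,db$: the first with kernel the density $p(s-b)$, the
  -- second, by Tonelli, with $r$ times the distribution function $F(s-b)$. They add up because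
  -- $p+rF=r\mathbf 1_{[0,\infty)}$. The additive form avoids subtraction in `ℝ≥0∞`.
  have h1 : ∀ a : ℝ, ∫⁻ q, G (a - q) ∂(expMeasure r) =
      ∫⁻ b, exponentialPDF r (a - b) * G b := by
    intro a
    rw [lintegral_expMeasure (by fun_prop),
      ← lintegral_sub_left_eq_self (fun q => exponentialPDF r q * G (a - q)) a]
    simp
  have h2 : ∫⁻ a in Set.Iic s, ∫⁻ b, exponentialPDF r (a - b) * G b =
      ∫⁻ b, expMeasure r (Set.Iic (s - b)) * G b := by
    rw [lintegral_lintegral_swap (by fun_prop)]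
    refine lintegral_congr fun b => ?_
    rw [lintegral_mul_const _ (by fun_prop), expMeasure, gammaMeasure,
      withDensity_apply _ measurableSet_Iic, ← lintegral_indicator measurableSet_Iic,
      ← lintegral_indicator measurableSet_Iic,
      ← lintegral_sub_right_eq_self (fun q => (Set.Iic (s - b)).indicator (gammaPDF 1 r) q) b]
    congr 1
    refine lintegral_congr fun a => ?_
    by_cases ha : a ≤ s
    · rw [Set.indicator_of_mem (Set.mem_Iic.2 ha), Set.indicator_of_mem (by simpa using ha)]
      rfl
    · rw [Set.indicator_of_notMem (by simpa using ha), Set.indicator_of_notMem (by simpa using ha)]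
  simp only [h1]
  have hI : Measurable fun x => expMeasure r (Set.Iic x) := by
    have : Monotone fun x => expMeasure r (Set.Iic x) :=
      fun x y hxy => measure_mono (Set.Iic_subset_Iic.2 hxy)
    exact this.measurable
  have hIG : Measurable fun b => expMeasure r (Set.Iic (s - b)) * G b :=
    (hI.comp (measurable_const.sub measurable_id)).mul hG
  rw [h2, ← lintegral_const_mul _ hIG,
    ← lintegral_add_left (by fun_prop),
    ← lintegral_const_mul _ hG, ← lintegral_indicator measurableSet_Iic]
  refine lintegral_congr fun b => ?_
  rw [← mul_assoc, ← add_mul, exponentialPDF_add_mul_expMeasure_Iic hr]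
  by_cases hb : b ≤ s
  · rw [Set.indicator_of_mem (by simpa using hb), Set.indicator_of_mem (by simpa using hb)]
    simp
  · rw [Set.indicator_of_notMem (by simpa using hb), Set.indicator_of_notMem (by simpa using hb)]
    simp

end ExpMeasure

/-! ### Reversibility and integrability of the jump rate -/

section Reversibility

variable {E : Type*} [MeasurableSpace E] {π : Measure E} {γ : Kernel E E}
  {t : E → E → ℝ≥0} {g : ℝ≥0 → ℝ≥0}

theorem measurable_balanced_ratio (ht : IsRatio π γ t) (hg : Monotone g) :
    Measurable fun p : E × E => g (t p.1 p.2) :=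
  hg.measurable.comp ht.measurable

/-- The measure `π(dx) γ(x, dy) g(t(x, y))` is symmetric. -/
theorem lintegral_flow_swap (ht : IsRatio π γ t) (hg : IsBalancing g)
    (hgt : Measurable fun p : E × E => g (t p.1 p.2)) {φ : E × E → ℝ≥0∞} (hφ : Measurable φ) :
    ∫⁻ p, (g (t p.1 p.2) : ℝ≥0∞) * φ p ∂(flow π γ) =
      ∫⁻ p, (g (t p.1 p.2) : ℝ≥0∞) * φ p.swap ∂(flow π γ) := by
  set R : Set (E × E) := {p | 0 < t p.1 p.2} with hR
  have hRm : MeasurableSet R := measurableSet_lt measurable_const ht.measurable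
  have hsymm : ∀ p : E × E, p.swap ∈ R ↔ p ∈ R := by
    have : ∀ p : E × E, p ∈ R → p.swap ∈ R := fun p hp => by
      have hp' : 0 < t p.1 p.2 := hp
      change 0 < t p.2 p.1
      rw [ht.inv _ _ hp']
      positivity
    exact fun p => ⟨fun h => this _ h, this p⟩
  have hrestr : ∀ ψ : E × E → ℝ≥0∞, ∫⁻ p, (g (t p.1 p.2) : ℝ≥0∞) * ψ p ∂(flow π γ) =
      ∫⁻ p in R, (g (t p.1 p.2) : ℝ≥0∞) * ψ p ∂(flow π γ) := by
    intro ψ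
    rw [← lintegral_indicator hRm]
    refine lintegral_congr fun p => ?_
    by_cases hp : p ∈ R
    · rw [Set.indicator_of_mem hp]
    · have : t p.1 p.2 = 0 := by simpa [hR] using hp
      rw [Set.indicator_of_notMem hp, this, hg.map_zero]
      simp
  have hswap : Measurable fun p : E × E => (g (t p.2 p.1) : ℝ≥0∞) * φ p :=
    (hgt.comp measurable_swap).coe_nnreal_ennreal.mul hφ
  -- On $R$, $g(t(x,y))=t(x,y)\,g(t(y,x))$. The factor $t$ changes `flow` into `revFlow`, and
  -- undoing the swap exchanges the arguments. Off $R$ nothing is lost, as $g(0)=0$.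
  calc ∫⁻ p, (g (t p.1 p.2) : ℝ≥0∞) * φ p ∂(flow π γ)
      = ∫⁻ p in R, (t p.1 p.2 : ℝ≥0∞) * ((g (t p.2 p.1) : ℝ≥0∞) * φ p) ∂(flow π γ) := by
        rw [hrestr]
        refine setLIntegral_congr_fun hRm fun p hp => ?_
        have hp' : 0 < t p.1 p.2 := hp
        rw [hg.balance _ hp', ← ht.inv _ _ hp', ENNReal.coe_mul, mul_assoc]
    _ = ∫⁻ p in R, (g (t p.2 p.1) : ℝ≥0∞) * φ p ∂(revFlow π γ) := by
        rw [ht.density, lintegral_withDensity_eq_lintegral_mul _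
          ht.measurable.coe_nnreal_ennreal hswap]
        rfl
    _ = ∫⁻ p in R, (g (t p.1 p.2) : ℝ≥0∞) * φ p.swap ∂(flow π γ) := by
        rw [revFlow, setLIntegral_map hRm hswap measurable_swap]
        have : Prod.swap ⁻¹' R = R := by
          ext p
          exact hsymm p
        rw [this]
        rfl
    _ = _ := (hrestr _).symm

/-- For $s\ge1$, balance and monotonicity give $g(s)=s\,g(1/s)\le s\,g(1)=s$. -/
theorem IsBalancing.le_one_add (hg : IsBalancing g) (hmono : Monotone g) (s : ℝ≥0) :
    g s ≤ 1 + s := by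
  rcases le_total s 1 with h | h
  · exact (hmono h).trans (hg.map_one.le.trans (by simp))
  · have hs : 0 < s := one_pos.trans_le h
    rw [hg.balance s hs]
    calc s * g (1 / s) ≤ s * 1 := by
          gcongr
          refine (hmono ?_).trans hg.map_one.le
          rw [one_div]
          exact inv_le_one_of_one_le₀ h
      _ ≤ 1 + s := by simp

variable [IsProbabilityMeasure π] [IsMarkovKernel γ]

theorem lintegral_rate_mul (ht : IsRatio π γ t) (hg : IsBalancing g)
    (hgt : Measurable fun p : E × E => g (t p.1 p.2)) {φ : E → ℝ≥0∞} (hφ : Measurable φ) :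
    ∫⁻ x, ∫⁻ y, (g (t x y) : ℝ≥0∞) * φ y ∂(γ x) ∂π = ∫⁻ x, rate γ t g x * φ x ∂π := by
  have h := lintegral_flow_swap ht hg hgt (hφ.comp measurable_snd)
  have h1 : Measurable fun p : E × E => (g (t p.1 p.2) : ℝ≥0∞) * (φ ∘ Prod.snd) p :=
    hgt.coe_nnreal_ennreal.mul (hφ.comp measurable_snd)
  have h2 : Measurable fun p : E × E => (g (t p.1 p.2) : ℝ≥0∞) * (φ ∘ Prod.snd) p.swap :=
    hgt.coe_nnreal_ennreal.mul (hφ.comp measurable_fst)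
  rw [flow, Measure.lintegral_compProd h1, Measure.lintegral_compProd h2] at h
  refine h.trans (lintegral_congr fun x => ?_)
  exact lintegral_mul_const (φ x)
    ((hgt.comp (measurable_prodMk_left (x := x))).coe_nnreal_ennreal)

theorem lintegral_rate_lt_top (ht : IsRatio π γ t) (hg : IsBalancing g) (hmono : Monotone g) :
    ∫⁻ x, rate γ t g x ∂π < ∞ := by
  have hgt := measurable_balanced_ratio ht hmono
  have hm := ht.measurable.coe_nnreal_ennreal
  have h1 : ∫⁻ x, rate γ t g x ∂π = ∫⁻ p, (g (t p.1 p.2) : ℝ≥0∞) ∂(flow π γ) := by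
    rw [flow, Measure.lintegral_compProd hgt.coe_nnreal_ennreal]
    rfl
  have hprob : IsProbabilityMeasure (flow π γ) := by unfold flow; infer_instance
  have hrev : IsProbabilityMeasure (revFlow π γ) := by
    unfold revFlow
    exact Measure.isProbabilityMeasure_map measurable_swap.aemeasurable
  -- This integral is the mass that the probability measure `revFlow` gives to $R$.
  have h2 : ∫⁻ p, (t p.1 p.2 : ℝ≥0∞) ∂(flow π γ) ≤ 1 := by
    set R : Set (E × E) := {p | 0 < t p.1 p.2} with hR
    have hRm : MeasurableSet R := measurableSet_lt measurable_const ht.measurable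
    calc ∫⁻ p, (t p.1 p.2 : ℝ≥0∞) ∂(flow π γ) = ∫⁻ p in R, (t p.1 p.2 : ℝ≥0∞) ∂(flow π γ) := by
          rw [← lintegral_indicator hRm]
          refine lintegral_congr fun p => ?_
          by_cases hp : p ∈ R
          · rw [Set.indicator_of_mem hp]
          · have : t p.1 p.2 = 0 := by simpa [hR] using hp
            rw [Set.indicator_of_notMem hp, this, ENNReal.coe_zero]
      _ = (revFlow π γ).restrict R Set.univ := by
          rw [ht.density, withDensity_apply _ MeasurableSet.univ, Measure.restrict_univ]
      _ ≤ revFlow π γ Set.univ := Measure.restrict_apply_le _ _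
      _ = 1 := measure_univ
  calc ∫⁻ x, rate γ t g x ∂π ≤ ∫⁻ p, (1 + (t p.1 p.2 : ℝ≥0∞)) ∂(flow π γ) := by
        rw [h1]
        exact lintegral_mono fun p => by
          simpa using ENNReal.coe_le_coe.2 (hg.le_one_add hmono (t p.1 p.2))
    _ = 1 + ∫⁻ p, (t p.1 p.2 : ℝ≥0∞) ∂(flow π γ) := by
        rw [lintegral_add_left measurable_const, lintegral_const, measure_univ, mul_one]
    _ ≤ 1 + 1 := by gcongr
    _ < ∞ := by simp

end Reversibility

/-! ### Distribution functions of the jump times -/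

section JumpTail

variable {E : Type*} [MeasurableSpace E] (γ : Kernel E E) [IsSFiniteKernel γ] {t : E → E → ℝ≥0}
  {g : ℝ≥0 → ℝ≥0} (hgt : Measurable fun p : E × E => g (t p.1 p.2))

/-- The probability `P_x(T_n ≤ s)`, by recursion on the first jump. -/
noncomputable def jumpTail : ℕ → E × ℝ → ℝ≥0∞
  | 0, p => (Set.Ici 0).indicator 1 p.2
  | n + 1, p => ∫⁻ z, jumpTail n (z.1, p.2 - z.2) ∂(stepKernel γ hgt p.1)

theorem measurable_jumpTail (n : ℕ) : Measurable (jumpTail γ hgt n) := by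
  induction n with
  | zero => exact (measurable_one.indicator measurableSet_Ici).comp measurable_snd
  | succ n ih =>
    exact Measurable.lintegral_kernel_prod_right'
      (κ := (stepKernel γ hgt).comap Prod.fst (measurable_fst (β := ℝ)))
      (f := fun q : (E × ℝ) × (E × ℝ) => jumpTail γ hgt n (q.2.1, q.1.2 - q.2.2))
      (ih.comp (by fun_prop))

variable {γ}

/-- `jumpTail` recurses on the first jump, whereas the Markov property is available at the last one.
Keeping $m$ general bridges the two: each induction step moves one jump from $n$ to $m$. -/
theorem IsLBMJP.lintegral_jumpTail {Ω : Type*} [MeasurableSpace Ω] {x : E} {P : Measure Ω}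
    {X : ℕ → Ω → E} {τ : ℕ → Ω → ℝ≥0} (hX : ∀ n, Measurable (X n)) (hτ : ∀ n, Measurable (τ n))
    (hY : IsLBMJP γ t g x P X τ) (s : ℝ) (m n : ℕ) :
    ∫⁻ ω, jumpTail γ hgt m (X n ω, s - jumpTime τ n ω) ∂P = jumpTail γ hgt (m + n) (x, s) := by
  have := hY.prob
  induction n generalizing m with
  | zero =>
    have : ∀ᵐ ω ∂P, jumpTail γ hgt m (X 0 ω, s - jumpTime τ 0 ω) = jumpTail γ hgt m (x, s) := by
      filter_upwards [hY.start] with ω hω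
      rw [hω, jumpTime_zero]
      simp
    rw [lintegral_congr_ae this, lintegral_const, measure_univ, mul_one, add_zero]
  | succ n ih =>
    have h := hY.setLIntegral_step hgt hX hτ n MeasurableSet.univ
      (φ := fun q => jumpTail γ hgt m (q.2.1, (s - q.1.2) - q.2.2))
      ((measurable_jumpTail γ hgt m).comp (by fun_prop))
    rw [Measure.restrict_univ] at h
    rw [show m + (n + 1) = (m + 1) + n by ring, ← ih (m + 1)]
    simp only [jumpTime_succ, NNReal.coe_add, ← sub_sub]
    exact h

theorem IsLBMJP.measure_jumpTime_le {Ω : Type*} [MeasurableSpace Ω] {x : E} {P : Measure Ω}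
    {X : ℕ → Ω → E} {τ : ℕ → Ω → ℝ≥0} (hX : ∀ n, Measurable (X n)) (hτ : ∀ n, Measurable (τ n))
    (hY : IsLBMJP γ t g x P X τ) (s : ℝ≥0) (n : ℕ) :
    P {ω | jumpTime τ n ω ≤ s} = jumpTail γ hgt n (x, s) := by
  have h := hY.lintegral_jumpTail hgt hX hτ s 0 n
  rw [zero_add] at h
  rw [← h, ← lintegral_indicator_one (measurableSet_le (measurable_jumpTime hτ n) measurable_const)]
  refine lintegral_congr fun ω => ?_
  simp only [jumpTail, Set.indicator_apply, Set.mem_ofPred_eq, Set.mem_Ici, sub_nonneg,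
    NNReal.coe_le_coe, Pi.one_apply]

/-- The renewal identity at rate $\lambda(x)$, applied to the mean of $u_n$ under
$\Gamma_g(x,\cdot)$. The factor $\lambda(x)$ cancels the normalisation of $\Gamma_g$ and leaves the
unnormalised kernel $g(t(x,y))\gamma(x,dy)$, which is symmetric under $\pi$. -/
theorem jumpTail_succ_add (n : ℕ) {x : E} (h0 : rate γ t g x ≠ 0) (htop : rate γ t g x ≠ ∞)
    (s : ℝ) :
    jumpTail γ hgt (n + 1) (x, s) +
        rate γ t g x * ∫⁻ a in Set.Iic s, jumpTail γ hgt (n + 1) (x, a) =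
      ∫⁻ y, (g (t x y) : ℝ≥0∞) * (∫⁻ a in Set.Iic s, jumpTail γ hgt n (y, a)) ∂(γ x) := by
  have hm := measurable_jumpTail γ hgt n
  have hG : Measurable fun a : ℝ => ∫⁻ y, jumpTail γ hgt n (y, a) ∂(jumpKernel γ hgt x) :=
    Measurable.lintegral_prod_right' (f := fun p : ℝ × E => jumpTail γ hgt n (p.2, p.1))
      (hm.comp measurable_swap)
  have h1 : ∀ a, jumpTail γ hgt (n + 1) (x, a) =
      ∫⁻ q, (∫⁻ y, jumpTail γ hgt n (y, a - q) ∂(jumpKernel γ hgt x))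
        ∂(expMeasure (rate γ t g x).toReal) := by
    intro a
    have hf : Measurable fun z : E × ℝ => jumpTail γ hgt n (z.1, a - z.2) :=
      hm.comp (by fun_prop)
    have : SFinite (expMeasure (rate γ t g x).toReal) :=
      inferInstanceAs (SFinite (holdKernel γ hgt x))
    rw [jumpTail, stepKernel, Kernel.prod_apply]
    exact lintegral_prod_symm' _ hf
  have h2 := lintegral_expMeasure_sub_add (ENNReal.toReal_pos h0 htop) hG s
  simp only [h1]
  rw [ENNReal.ofReal_toReal htop] at h2
  rw [h2, lintegral_lintegral_swap (f := fun a y => jumpTail γ hgt n (y, a))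
    (hm.comp measurable_swap).aemeasurable]
  have hI : Measurable fun y => ∫⁻ a in Set.Iic s, jumpTail γ hgt n (y, a) :=
    Measurable.lintegral_prod_right' hm
  have h3 := lintegral_jumpLaw γ hgt x hI
  have hg : Measurable fun y => (g (t x y) : ℝ≥0∞) * ∫⁻ a in Set.Iic s, jumpTail γ hgt n (y, a) :=
    (hgt.comp measurable_prodMk_left).coe_nnreal_ennreal.mul hI
  have h4 : ∫⁻ y, (∫⁻ a in Set.Iic s, jumpTail γ hgt n (y, a)) ∂(jumpLaw γ t g x) =
      (rate γ t g x)⁻¹ *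
        ∫⁻ y, (g (t x y) : ℝ≥0∞) * (∫⁻ a in Set.Iic s, jumpTail γ hgt n (y, a)) ∂(γ x) := by
    rw [h3, ← lintegral_const_mul _ hg]
    refine lintegral_congr fun y => ?_
    rw [div_eq_mul_inv]
    ring
  change rate γ t g x * ∫⁻ y, _ ∂(jumpLaw γ t g x) = _
  rw [h4, ← mul_assoc, ENNReal.mul_inv_cancel h0 htop, one_mul]

end JumpTail

theorem lintegral_numJumps {Ω : Type*} [MeasurableSpace Ω] {P : Measure Ω} {τ : ℕ → Ω → ℝ≥0}
    (hτ : ∀ n, Measurable (τ n)) (s : ℝ≥0) :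
    ∫⁻ ω, (numJumps τ s ω : ℝ≥0∞) ∂P = ∑' n, P {ω | jumpTime τ (n + 1) ω ≤ s} := by
  have hm : ∀ n, MeasurableSet {ω | jumpTime τ (n + 1) ω ≤ s} := fun n =>
    measurableSet_le (measurable_jumpTime hτ _) measurable_const
  simp only [coe_numJumps_eq_tsum]
  rw [lintegral_tsum fun n => (measurable_const.indicator (hm n)).aemeasurable]
  exact tsum_congr fun n => lintegral_indicator_one (hm n)

/-! ### Finite expected jump counts from almost every start -/

section Nonexplosion

variable {E : Type*} [MeasurableSpace E] {π : Measure E} [IsProbabilityMeasure π] {γ : Kernel E E}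
  [IsMarkovKernel γ] {t : E → E → ℝ≥0} {g : ℝ≥0 → ℝ≥0}

/-- In stationarity the expected number of jumps in `[0, s]` is at most `s π(λ)`. -/
theorem lintegral_tsum_jumpTail_le (ht : IsRatio π γ t) (hg : IsBalancing g)
    (hgt : Measurable fun p : E × E => g (t p.1 p.2)) (h0 : ∀ᵐ x ∂π, rate γ t g x ≠ 0)
    (htop : ∀ᵐ x ∂π, rate γ t g x ≠ ∞) (s : ℝ) :
    ∫⁻ x, ∑' n, jumpTail γ hgt (n + 1) (x, s) ∂π ≤
      ENNReal.ofReal s * ∫⁻ x, rate γ t g x ∂π := by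
  set U : ℕ → E → ℝ≥0∞ := fun n x => ∫⁻ a in Set.Iic s, jumpTail γ hgt n (x, a) with hU
  have hUm : ∀ n, Measurable (U n) := fun n =>
    Measurable.lintegral_prod_right' (measurable_jumpTail γ hgt n)
  have hus : ∀ n, Measurable fun x => jumpTail γ hgt n (x, s) := fun n =>
    (measurable_jumpTail γ hgt n).comp measurable_prodMk_right
  have hrec : ∀ n, ∫⁻ x, jumpTail γ hgt (n + 1) (x, s) ∂π + ∫⁻ x, rate γ t g x * U (n + 1) x ∂π =
      ∫⁻ x, rate γ t g x * U n x ∂π := by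
    intro n
    rw [← lintegral_add_left (hus _), ← lintegral_rate_mul ht hg hgt (hUm n)]
    refine lintegral_congr_ae ?_
    filter_upwards [h0, htop] with x hx0 hxtop
    exact jumpTail_succ_add hgt n hx0 hxtop s
  -- Telescoping with the remainder $\int\lambda U_N\,d\pi$ kept on the left; it is dropped when the
  -- partial sums are bounded.
  have hsum : ∀ N, ∑ n ∈ Finset.range N, ∫⁻ x, jumpTail γ hgt (n + 1) (x, s) ∂π +
      ∫⁻ x, rate γ t g x * U N x ∂π = ∫⁻ x, rate γ t g x * U 0 x ∂π := by
    intro N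
    induction N with
    | zero => simp
    | succ N ih => rw [Finset.sum_range_succ, add_assoc, hrec, ih]
  have hU0 : ∀ x, U 0 x = ENNReal.ofReal s := by
    intro x
    simp only [hU, jumpTail]
    rw [lintegral_indicator_one measurableSet_Ici, Measure.restrict_apply measurableSet_Ici,
      Set.Ici_inter_Iic, Real.volume_Icc, sub_zero]
  rw [lintegral_tsum fun n => (hus (n + 1)).aemeasurable, ENNReal.tsum_eq_iSup_nat]
  refine iSup_le fun N => ?_
  calc _ ≤ ∫⁻ x, rate γ t g x * U 0 x ∂π := hsum N ▸ le_self_add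
    _ = _ := by
      simp only [hU0]
      rw [lintegral_mul_const _ (measurable_rate γ hgt), mul_comm]

theorem ae_rate_lt_top (ht : IsRatio π γ t) (hg : IsBalancing g) (hmono : Monotone g) :
    ∀ᵐ x ∂π, rate γ t g x < ∞ :=
  ae_lt_top (measurable_rate γ (measurable_balanced_ratio ht hmono))
    (lintegral_rate_lt_top ht hg hmono).ne

variable {Ω : Type*} [MeasurableSpace Ω]

theorem ae_mem_goodStarts [TopologicalSpace E] [HereditarilyLindelofSpace E]
    (ht : IsRatio π γ t) (hg : IsBalancing g) (hmono : Monotone g)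
    {P : E → Measure Ω} {X : ℕ → Ω → E} {τ : ℕ → Ω → ℝ≥0} (hX : ∀ n, Measurable (X n))
    (hτ : ∀ n, Measurable (τ n))
    (hY : ∀ x ∈ π.support, rate γ t g x < ∞ → IsLBMJP γ t g x (P x) X τ)
    (hpos : ∀ x ∈ π.support, 0 < rate γ t g x) :
    ∀ᵐ x ∂π, x ∈ goodStarts γ t g π P τ := by
  have hgt := measurable_balanced_ratio ht hmono
  have hsupp : ∀ᵐ x ∂π, x ∈ π.support := Measure.support_mem_ae
  have htop := ae_rate_lt_top ht hg hmono
  have h0 : ∀ᵐ x ∂π, rate γ t g x ≠ 0 := by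
    filter_upwards [hsupp] with x hx using (hpos x hx).ne'
  have hfin : ∀ᵐ x ∂π, ∀ k : ℕ, ∑' n, jumpTail γ hgt (n + 1) (x, (k : ℝ≥0)) < ∞ := by
    refine ae_all_iff.2 fun k => ae_lt_top (Measurable.tsum fun n =>
      (measurable_jumpTail γ hgt _).comp measurable_prodMk_right) ?_
    refine ((lintegral_tsum_jumpTail_le ht hg hgt h0 (htop.mono fun x hx => hx.ne) _).trans_lt
      ?_).ne
    exact ENNReal.mul_lt_top ENNReal.ofReal_lt_top (lintegral_rate_lt_top ht hg hmono)
  filter_upwards [hsupp, htop, hfin] with x hx hxtop hxfin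
  refine ⟨hx, hxtop, fun s _ => ?_⟩
  obtain ⟨k, hk⟩ := exists_nat_ge s
  have hYx := hY x hx hxtop
  refine lt_of_le_of_lt ?_ (hxfin k)
  rw [lintegral_numJumps hτ]
  refine ENNReal.tsum_le_tsum fun n => ?_
  rw [← hYx.measure_jumpTime_le hgt hX hτ]
  exact measure_mono fun ω hω => le_trans hω hk

end Nonexplosion

/-! ### Adaptedness of path integrals -/

section Adapted

open Filter Topology

variable {E Ω : Type*} [MeasurableSpace E] {X : ℕ → Ω → E} {τ : ℕ → Ω → ℝ≥0}

theorem measurable_extend {f : E → ℝ} (hf : Measurable f) : Measurable (extend f) :=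
  measurable_fun_sum hf measurable_const

/-- The upper grid approximations `⌈(n + 1) r⌉ / (n + 1)` converge to `r`. -/
theorem tendsto_ceil_div (r : ℝ≥0) :
    Tendsto (fun n : ℕ => (⌈r * (n + 1)⌉₊ : ℝ≥0) / (n + 1)) atTop (𝓝 r) := by
  have h : Tendsto (fun n : ℕ => r + 1 / ((n : ℝ≥0) + 1)) atTop (𝓝 (r + 0)) :=
    tendsto_const_nhds.add tendsto_one_div_add_atTop_nhds_zero_nat
  rw [add_zero] at h
  refine tendsto_of_tendsto_of_tendsto_of_le_of_le tendsto_const_nhds h (fun n => ?_) fun n => ?_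
  · dsimp only
    rw [le_div_iff₀ (by positivity)]
    exact Nat.le_ceil _
  · dsimp only
    rw [div_le_iff₀ (by positivity), add_mul, one_div, inv_mul_cancel₀ (by positivity)]
    exact (Nat.ceil_lt_add_one (by positivity)).le

theorem le_ceil_div (r : ℝ≥0) (n : ℕ) : r ≤ (⌈r * (n + 1)⌉₊ : ℝ≥0) / (n + 1) := by
  rw [le_div_iff₀ (by positivity)]
  exact Nat.le_ceil _

/-- A process that is right-continuous for the discrete topology is progressively measurable. -/
theorem measurable_uncurry_min {m : MeasurableSpace Ω} {s : ℝ≥0} {F : ℝ≥0 → Ω → ℝ}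
    (hF : ∀ r ≤ s, Measurable (F r))
    (hright : ∀ ω r, ∃ b, r < b ∧ ∀ q, r ≤ q → q < b → F q ω = F r ω) :
    Measurable fun p : Ω × ℝ => F (min s p.2.toNNReal) p.1 := by
  have happrox : ∀ n : ℕ, Measurable fun p : Ω × ℝ =>
      F (min s ((⌈p.2.toNNReal * (n + 1)⌉₊ : ℝ≥0) / (n + 1))) p.1 := by
    intro n
    obtain ⟨q, hq⟩ : ∃ q : ℕ → ℝ≥0, q = fun k : ℕ => min s ((k : ℝ≥0) / (n + 1)) := ⟨_, rfl⟩
    have h1 : Measurable fun z : ℕ × Ω => F (q z.1) z.2 :=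
      measurable_from_prod_countable_right fun k => hF (q k) (hq ▸ min_le_left _ _)
    have h0 : Measurable fun p : Ω × ℝ => p.2.toNNReal * (n + 1) :=
      measurable_snd.real_toNNReal.mul_const _
    have h2 : Measurable fun p : Ω × ℝ => (⌈p.2.toNNReal * (n + 1)⌉₊, p.1) :=
      (Nat.measurable_ceil.comp h0).prodMk measurable_fst
    have h3 := h1.comp h2
    rw [hq] at h3
    exact h3
  refine measurable_of_tendsto_metrizable happrox (tendsto_pi_nhds.2 fun p => ?_)
  obtain ⟨b, hb, hconst⟩ := hright p.1 (min s p.2.toNNReal)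
  have hlim := (tendsto_const_nhds (x := s)).min (tendsto_ceil_div p.2.toNNReal)
  -- The grid points approach from the right, so they eventually lie in the interval where the path
  -- is constant, and the approximations are eventually exact.
  refine tendsto_const_nhds.congr' ?_
  filter_upwards [hlim.eventually (gt_mem_nhds hb)] with n hn
  rw [hconst _ (min_le_min_left _ (le_ceil_div _ n)) hn]

/-- The cap $\min(s,r)$, inactive on $(0,s]$, makes the integrand depend only on the path up to $s$
for every real $r$, so joint measurability holds with the σ-algebra of the past. -/
theorem stronglyMeasurable_integral_extend_proc {m : MeasurableSpace Ω} {s : ℝ≥0}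
    (hm : ∀ r ≤ s, Measurable (proc X τ r)) {f : E → ℝ} (hf : Measurable f) :
    StronglyMeasurable fun ω =>
      ∫ r in Set.Ioc 0 (s : ℝ), extend f (proc X τ (min s r.toNNReal) ω) := by
  have h := measurable_uncurry_min (F := fun r ω => extend f (proc X τ r ω))
    (fun r hr => (measurable_extend hf).comp (hm r hr)) fun ω r => by
      obtain ⟨b, hb, hconst⟩ := exists_proc_eq_on_Ico X τ ω r
      exact ⟨b, hb, fun q hq hq' => by rw [hconst q hq hq']⟩
  exact h.stronglyMeasurable.integral_prod_right'

theorem measurable_natFiltration_proc [MeasurableSpace Ω] (hX : ∀ n, Measurable (X n))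
    (hτ : ∀ n, Measurable (τ n)) {r s : ℝ≥0} (hrs : r ≤ s) :
    Measurable[natFiltration hX hτ s] (proc X τ r) :=
  (comap_measurable _).mono
    (le_iSup₂ (f := fun r (_ : r ≤ s) => MeasurableSpace.comap (proc X τ r) inferInstance) r hrs)
    le_rfl

theorem stronglyMeasurable_mart [mΩ : MeasurableSpace Ω] (hX : ∀ n, Measurable (X n))
    (hτ : ∀ n, Measurable (τ n)) {f h : E → ℝ} (hf : Measurable f) (hh : Measurable h) (x : E)
    (s : ℝ≥0) : StronglyMeasurable[natFiltration hX hτ s] (mart X τ f h x s) := by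
  have hm : ∀ r ≤ s, Measurable[natFiltration hX hτ s] (proc X τ r) :=
    fun r hr => measurable_natFiltration_proc hX hτ hr
  have h1 : Measurable[natFiltration hX hτ s] fun ω => extend f (proc X τ s ω) :=
    (measurable_extend hf).comp (hm s le_rfl)
  have h3 := stronglyMeasurable_integral_extend_proc hm hh
  have h4 : mart X τ f h x s = fun ω => extend f (proc X τ s ω) - f x -
      ∫ r in Set.Ioc 0 (s : ℝ), extend h (proc X τ (min s r.toNNReal) ω) := by
    funext ω
    rw [mart, intervalIntegral.integral_of_le s.coe_nonneg]
    congr 1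
    refine setIntegral_congr_fun measurableSet_Ioc fun r hr => ?_
    have : min s r.toNNReal = r.toNNReal := min_eq_right (Real.toNNReal_le_iff_le_coe.2 hr.2)
    simp only [this]
  rw [h4]
  exact (h1.stronglyMeasurable.sub stronglyMeasurable_const).sub h3

end Adapted

/-! ### The natural filtration before the next jump -/

section Past

variable {E Ω : Type*} [MeasurableSpace E] {X : ℕ → Ω → E} {τ : ℕ → Ω → ℝ≥0}

/-- The events that, before the jump `k + 1`, are determined by the first `k` jumps if this
jump happens after the time `u`. -/
@[reducible]
def pastEvents (X : ℕ → Ω → E) (τ : ℕ → Ω → ℝ≥0) (u : ℝ≥0) (k : ℕ) : MeasurableSpace Ω where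
  MeasurableSet' A := ∃ B, MeasurableSet[history X τ k] B ∧
    ∀ ω, u < jumpTime τ (k + 1) ω → (ω ∈ A ↔ ω ∈ B)
  measurableSet_empty := ⟨∅, @MeasurableSet.empty _ (history X τ k), fun _ _ => Iff.rfl⟩
  measurableSet_compl := by
    rintro A ⟨B, hB, h⟩
    exact ⟨Bᶜ, hB.compl, fun ω hω => not_congr (h ω hω)⟩
  measurableSet_iUnion := by
    intro A hA
    choose B hB h using hA
    refine ⟨⋃ i, B i, MeasurableSet.iUnion hB, fun ω hω => ?_⟩
    simp only [Set.mem_iUnion, h _ ω hω]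

theorem natFiltration_le_pastEvents [MeasurableSpace Ω] (hX : ∀ n, Measurable (X n))
    (hτ : ∀ n, Measurable (τ n)) (u : ℝ≥0) (k : ℕ) :
    natFiltration hX hτ u ≤ pastEvents X τ u k := by
  refine iSup₂_le fun r hr => ?_
  rintro _ ⟨C, hC, rfl⟩
  -- The union is over the index $j\le k$ with $Y_r=X_j$. For $j=k$ the condition $r<T_{k+1}$ must
  -- be left out, since $T_{k+1}$ is not part of the history; it holds anyway on $\{u<T_{k+1}\}$.
  refine ⟨⋃ j ∈ Set.Iic k, {ω | jumpTime τ j ω ≤ r} ∩ {ω | j < k → r < jumpTime τ (j + 1) ω} ∩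
    X j ⁻¹' (Sum.inl ⁻¹' C), ?_, fun ω hω => ?_⟩
  · refine MeasurableSet.biUnion (Set.to_countable _) fun j hj => ?_
    have hj : j ≤ k := hj
    refine ((measurable_history_jumpTime X τ hj measurableSet_Iic).inter ?_).inter
      (measurable_history_state X τ hj (measurable_inl hC))
    by_cases hjk : j < k
    · simp only [hjk, true_imp_iff]
      exact measurable_history_jumpTime X τ (Nat.succ_le_iff.2 hjk) measurableSet_Ioi
    · simp only [hjk, false_imp_iff]
      exact MeasurableSet.univ
  · obtain ⟨N, hN, h1, h2⟩ := exists_jumpTime_le_lt (hr.trans_lt hω)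
    simp only [Set.mem_preimage, proc_eq h1 h2, Set.mem_iUnion, Set.mem_inter_iff, Set.mem_Iic,
      Set.mem_ofPred_eq, exists_prop]
    refine ⟨fun h => ⟨N, by omega, ⟨h1, fun _ => h2⟩, h⟩, ?_⟩
    rintro ⟨j, hj, ⟨hj1, hj2⟩, hj3⟩
    have hj4 : r < jumpTime τ (j + 1) ω := by
      rcases hj.lt_or_eq with hlt | rfl
      exacts [hj2 hlt, hr.trans_lt hω]
    have : N = j := by exact_mod_cast (numJumps_eq h1 h2).symm.trans (numJumps_eq hj1 hj4)
    rwa [this]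

end Past

/-! ### Decomposition of the martingale over sojourns -/

section Increments

variable {E Ω : Type*} {X : ℕ → Ω → E} {τ : ℕ → Ω → ℝ≥0} {ω : Ω} {s : ℝ≥0}

/-- The contribution of the jump `k + 1`, and of the sojourn before it, to the process `mart`
at the time `s`. -/
noncomputable def martIncr (X : ℕ → Ω → E) (τ : ℕ → Ω → ℝ≥0) (f h : E → ℝ) (s : ℝ≥0)
    (k : ℕ) (ω : Ω) : ℝ :=
  (f (X (k + 1) ω) - f (X k ω)) * {ω | jumpTime τ (k + 1) ω ≤ s}.indicator 1 ω -
    h (X k ω) * (min s (jumpTime τ (k + 1) ω) - jumpTime τ k ω : ℝ≥0)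

theorem mart_eq_tsum_martIncr (f h : E → ℝ) {m : ℕ} (hm : s < jumpTime τ m ω) :
    mart X τ f h (X 0 ω) s ω = ∑' k, martIncr X τ f h s k ω := by
  have hzero : ∀ k ∉ Finset.range m, martIncr X τ f h s k ω = 0 := by
    intro k hk
    have hmk : m ≤ k := by simpa using hk
    have h1 : s < jumpTime τ k ω := hm.trans_le (monotone_jumpTime τ ω hmk)
    have h2 : s < jumpTime τ (k + 1) ω := hm.trans_le (monotone_jumpTime τ ω (by omega : m ≤ k + 1))
    rw [martIncr, Set.indicator_of_notMem (by simpa using h2), min_eq_left h2.le,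
      tsub_eq_zero_of_le h1.le]
    simp
  obtain ⟨N, hN, h1, h2⟩ := exists_jumpTime_le_lt hm
  have hjumps : ∑ k ∈ Finset.range m, (f (X (k + 1) ω) - f (X k ω)) *
      {ω | jumpTime τ (k + 1) ω ≤ s}.indicator (1 : Ω → ℝ) ω = f (X N ω) - f (X 0 ω) := by
    rw [← Finset.sum_range_sub (fun k => f (X k ω)) N]
    have hsub : Finset.range N ⊆ Finset.range m := Finset.range_subset_range.2 hN.le
    rw [← Finset.sum_subset hsub]
    · refine Finset.sum_congr rfl fun k hk => ?_
      have hk' : k + 1 ≤ N := Finset.mem_range.1 hk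
      rw [Set.indicator_of_mem (by exact (monotone_jumpTime τ ω hk').trans h1)]
      simp
    · intro k _ hk
      have hk' : N + 1 ≤ k + 1 := by simpa using hk
      have := h2.trans_le (monotone_jumpTime τ ω hk')
      rw [Set.indicator_of_notMem (by simpa using this), mul_zero]
  rw [tsum_eq_sum hzero, mart, integral_extend_proc X h hm, proc_eq h1 h2]
  simp only [martIncr, Finset.sum_sub_distrib, hjumps]
  rfl

/-- Contribution $k$ is frozen once jump $k+1$ has occurred. This settles the part of an event of
$\mathcal F_u$ not controlled by the first $k$ jumps. -/
theorem martIncr_eq_of_jumpTime_le (f h : E → ℝ) {u : ℝ≥0} (hus : u ≤ s) {k : ℕ}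
    (hk : jumpTime τ (k + 1) ω ≤ u) : martIncr X τ f h s k ω = martIncr X τ f h u k ω := by
  rw [martIncr, martIncr, min_eq_right hk, min_eq_right (hk.trans hus),
    
    Set.indicator_of_mem (by exact hk.trans hus), Set.indicator_of_mem (by exact hk)]

end Increments

/-! ### Truncated exponential sojourns -/

section Sojourn

theorem expMeasure_Iio_zero (r : ℝ) : expMeasure r (Set.Iio 0) = 0 := by
  rw [expMeasure, gammaMeasure, withDensity_apply _ measurableSet_Iio]
  exact setLIntegral_eq_zero measurableSet_Iio fun x hx => exponentialPDF_of_neg hx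

theorem ae_nonneg_expMeasure (r : ℝ) : ∀ᵐ q ∂(expMeasure r), 0 ≤ q := by
  rw [ae_iff]
  simp only [not_le]
  exact expMeasure_Iio_zero r

/-- The expected length of a sojourn up to the time `b`. -/
theorem mul_lintegral_min_expMeasure {r : ℝ} (hr : 0 < r) (b : ℝ) :
    ENNReal.ofReal r * ∫⁻ q, ENNReal.ofReal (min b q) ∂(expMeasure r) =
      expMeasure r (Set.Iic b) := by
  have := isProbabilityMeasure_expMeasure hr
  set K := ∫⁻ a in Set.Iic b, expMeasure r (Set.Iic a) with hK
  have h1 : ∀ a : ℝ, ∫⁻ q, (Set.Ici (0 : ℝ)).indicator (1 : ℝ → ℝ≥0∞) (a - q) ∂(expMeasure r) =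
      expMeasure r (Set.Iic a) := by
    intro a
    rw [← lintegral_indicator_one measurableSet_Iic]
    refine lintegral_congr fun q => ?_
    simp only [Set.indicator_apply, Set.mem_Ici, sub_nonneg, Set.mem_Iic, Pi.one_apply]
  -- With $G=\mathbf 1_{[0,\infty)}$ the renewal identity reads $F(b)+rK=r\,b^+$. Since $K=\mathbb
  -- E(b-\tau)^+$ and $\min(b,\tau)^++(b-\tau)^+=b^+$, cancelling the finite term $rK$ gives the
  -- claim.
  have h2 := lintegral_expMeasure_sub_add hr
    ((measurable_one (α := ℝ≥0∞) (β := ℝ)).indicator (measurableSet_Ici (a := (0 : ℝ)))) b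
  simp only [h1] at h2
  rw [lintegral_indicator_one measurableSet_Ici, Measure.restrict_apply measurableSet_Ici,
    Set.Ici_inter_Iic, Real.volume_Icc, sub_zero] at h2
  have h3 : K = ∫⁻ q, ENNReal.ofReal (b - q) ∂(expMeasure r) := by
    have hm : MeasurableSet {p : ℝ × ℝ | p.2 ≤ p.1} :=
      measurableSet_le measurable_snd measurable_fst
    have e1 : K = ∫⁻ a in Set.Iic b, ∫⁻ q, {p : ℝ × ℝ | p.2 ≤ p.1}.indicator 1 (a, q)
        ∂(expMeasure r) := by
      refine lintegral_congr fun a => ?_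
      rw [← lintegral_indicator_one measurableSet_Iic]
      rfl
    rw [e1, lintegral_lintegral_swap (f := fun a q => {p : ℝ × ℝ | p.2 ≤ p.1}.indicator 1 (a, q))
      (measurable_one.indicator hm).aemeasurable]
    refine lintegral_congr fun q => ?_
    have e2 : (fun a : ℝ => {p : ℝ × ℝ | p.2 ≤ p.1}.indicator (1 : ℝ × ℝ → ℝ≥0∞) (a, q)) =
        (Set.Ici q).indicator 1 := rfl
    rw [e2, lintegral_indicator_one measurableSet_Ici, Measure.restrict_apply measurableSet_Ici,
      Set.Ici_inter_Iic, Real.volume_Icc]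
  have h4 : ∫⁻ q, ENNReal.ofReal (min b q) ∂(expMeasure r) + K = ENNReal.ofReal b := by
    rw [h3, ← lintegral_add_left (by fun_prop)]
    have : ∀ᵐ q ∂(expMeasure r),
        ENNReal.ofReal (min b q) + ENNReal.ofReal (b - q) = ENNReal.ofReal b := by
      filter_upwards [ae_nonneg_expMeasure r] with q hq
      rcases le_total b q with h | h
      · rw [min_eq_left h, ENNReal.ofReal_of_nonpos (sub_nonpos.2 h), add_zero]
      · rw [min_eq_right h, ← ENNReal.ofReal_add hq (sub_nonneg.2 h), add_sub_cancel]
    rw [lintegral_congr_ae this, lintegral_const, measure_univ, mul_one]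
  have hKtop : ENNReal.ofReal r * K ≠ ∞ :=
    ENNReal.mul_ne_top ENNReal.ofReal_ne_top
      (ne_top_of_le_ne_top ENNReal.ofReal_ne_top (h4 ▸ le_add_self))
  rw [← h4, mul_add] at h2
  exact ((ENNReal.add_left_inj hKtop).1 h2).symm

theorem integral_min_expMeasure {r : ℝ} (hr : 0 < r) (b : ℝ) :
    ∫ q, max (min b q) 0 ∂(expMeasure r) = r⁻¹ * (expMeasure r).real (Set.Iic b) := by
  rw [integral_eq_lintegral_of_nonneg_ae (f := fun q => max (min b q) 0)
    (Filter.Eventually.of_forall fun q => le_max_right _ _)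
    (by fun_prop), measureReal_def, ← mul_lintegral_min_expMeasure hr, ENNReal.toReal_mul,
    ENNReal.toReal_ofReal hr.le, inv_mul_cancel_left₀ hr.ne']
  simp

theorem coe_sojourn {Ω : Type*} (τ : ℕ → Ω → ℝ≥0) (s : ℝ≥0) (k : ℕ) (ω : Ω) :
    ((min s (jumpTime τ (k + 1) ω) - jumpTime τ k ω : ℝ≥0) : ℝ) =
      max (min ((s : ℝ) - jumpTime τ k ω) (τ (k + 1) ω)) 0 := by
  rw [NNReal.coe_sub_def, NNReal.coe_min, jumpTime_succ, NNReal.coe_add, ← min_sub_sub_right]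
  simp

end Sojourn

/-! ### Bounds and identities for the generator -/

section Generator

variable {E : Type*} [MeasurableSpace E] {γ : Kernel E E} {t : E → E → ℝ≥0} {g : ℝ≥0 → ℝ≥0}
  {f : E → ℝ}

theorem measurable_genL [IsSFiniteKernel γ] (hgt : Measurable fun p : E × E => g (t p.1 p.2))
    (hf : Measurable f) : Measurable (genL γ t g f) := by
  have : Measurable fun p : E × E => (g (t p.1 p.2) : ℝ) * (f p.2 - f p.1) :=
    hgt.coe_nnreal_real.mul ((hf.comp measurable_snd).sub (hf.comp measurable_fst))
  exact (this.stronglyMeasurable.integral_kernel_prod_right' (κ := γ)).measurable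

theorem enorm_genL_le (hgt : Measurable fun p : E × E => g (t p.1 p.2)) {C : ℝ}
    (hC : ∀ y, |f y| ≤ C) (x : E) :
    ‖genL γ t g f x‖ₑ ≤ ENNReal.ofReal (2 * C) * rate γ t g x := by
  calc ‖genL γ t g f x‖ₑ ≤ ∫⁻ y, ‖(g (t x y) : ℝ) * (f y - f x)‖ₑ ∂(γ x) :=
        enorm_integral_le_lintegral_enorm _
    _ ≤ ∫⁻ y, ENNReal.ofReal (2 * C) * (g (t x y) : ℝ≥0∞) ∂(γ x) := by
        refine lintegral_mono fun y => ?_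
        rw [enorm_mul, mul_comm, Real.enorm_eq_ofReal (g (t x y)).coe_nonneg,
          ENNReal.ofReal_coe_nnreal, Real.enorm_eq_ofReal_abs]
        gcongr
        have := abs_sub (f y) (f x)
        linarith [hC x, hC y]
    _ = _ := lintegral_const_mul _ (hgt.comp measurable_prodMk_left).coe_nnreal_ennreal

theorem integral_jumpLaw_sub (hgt : Measurable fun p : E × E => g (t p.1 p.2)) (x : E)
    (h0 : rate γ t g x ≠ 0) :
    ∫ y, (f y - f x) ∂(jumpLaw γ t g x) = (rate γ t g x).toReal⁻¹ * genL γ t g f x := by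
  have hm : Measurable fun y => (g (t x y) : ℝ≥0∞) / rate γ t g x :=
    (hgt.comp measurable_prodMk_left).coe_nnreal_ennreal.div_const _
  rw [jumpLaw, integral_withDensity_eq_integral_toReal_smul hm
    (Filter.Eventually.of_forall fun y => ENNReal.div_lt_top ENNReal.coe_ne_top h0), genL,
    ← integral_const_mul]
  refine integral_congr_ae (Filter.Eventually.of_forall fun y => ?_)
  simp only [ENNReal.toReal_div, ENNReal.coe_toReal, smul_eq_mul]
  ring

theorem isProbabilityMeasure_jumpLaw (hgt : Measurable fun p : E × E => g (t p.1 p.2)) {x : E}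
    (h0 : rate γ t g x ≠ 0) (htop : rate γ t g x ≠ ∞) :
    IsProbabilityMeasure (jumpLaw γ t g x) :=
  ⟨by rw [jumpLaw_apply_univ γ hgt, ENNReal.div_self h0 htop]⟩

end Generator

/-! ### Sojourn contributions: integrability and centring -/

section Increments

variable {E Ω : Type*} [MeasurableSpace E] [mΩ : MeasurableSpace Ω] {γ : Kernel E E}
  {t : E → E → ℝ≥0} {g : ℝ≥0 → ℝ≥0}
  {x : E} {P : Measure Ω} {X : ℕ → Ω → E} {τ : ℕ → Ω → ℝ≥0} {f : E → ℝ}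

/-- The complement of the support is adjoined to $N$, so that the induction keeps the chain inside
the support, the only place where absolute continuity of the jump law is assumed. -/
theorem IsLBMJP.ae_notMem_of_null [TopologicalSpace E] [HereditarilyLindelofSpace E]
    [OpensMeasurableSpace E] {π : Measure E} (hY : IsLBMJP γ t g x P X τ)
    (hac : ∀ x ∈ π.support, ∀ A : Set E, MeasurableSet A → π A = 0 → jumpLaw γ t g x A = 0)
    (hx : x ∈ π.support) {N : Set E} (hN : MeasurableSet N) (hπN : π N = 0) (hxN : x ∉ N) :
    ∀ᵐ ω ∂P, ∀ n, X n ω ∉ N := by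
  have hN'm : MeasurableSet (N ∪ π.supportᶜ) :=
    hN.union Measure.isClosed_support.measurableSet.compl
  have hN'0 : π (N ∪ π.supportᶜ) = 0 :=
    measure_union_null hπN Measure.measure_compl_support
  have key : ∀ n, ∀ᵐ ω ∂P, X n ω ∉ N ∪ π.supportᶜ := by
    intro n
    induction n with
    | zero =>
      filter_upwards [hY.start] with ω hω
      rw [hω]
      simp [hxN, hx]
    | succ n ih =>
      have h := hY.chain n (fun _ => Set.univ) (N ∪ π.supportᶜ) (fun _ => .univ) hN'm
      rw [ae_iff]
      simp only [not_not]
      simp only [Set.mem_univ, implies_true, true_and, Set.ofPred_true, Measure.restrict_univ] at h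
      rw [h]
      refine (lintegral_congr_ae (g := fun _ => 0) ?_).trans lintegral_zero
      filter_upwards [ih] with ω hω
      refine hac _ ?_ _ hN'm hN'0
      by_contra hc
      exact hω (Or.inr hc)
  filter_upwards [ae_all_iff.2 key] with ω hω n hn using hω n (Or.inl hn)

variable [IsSFiniteKernel γ] (hgt : Measurable fun p : E × E => g (t p.1 p.2))
  (hX : ∀ n, Measurable (X n)) (hτ : ∀ n, Measurable (τ n)) (hY : IsLBMJP γ t g x P X τ)
include hgt hX hτ hY

/-- The compensator identity for one jump. It controls the integral of $Lf$ over a sojourn although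
$\lambda$, and hence $Lf$, may be unbounded. -/
theorem IsLBMJP.lintegral_rate_mul_sojourn (s : ℝ≥0) (k : ℕ)
    (hgood : ∀ᵐ ω ∂P, rate γ t g (X k ω) ≠ 0 ∧ rate γ t g (X k ω) ≠ ∞) :
    ∫⁻ ω, rate γ t g (X k ω) * (min s (jumpTime τ (k + 1) ω) - jumpTime τ k ω : ℝ≥0) ∂P =
      P {ω | jumpTime τ (k + 1) ω ≤ s} := by
  have hm1 : Measurable fun q : (E × ℝ) × (E × ℝ) =>
      rate γ t g q.1.1 * ENNReal.ofReal (min (s - q.1.2) q.2.2) :=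
    ((measurable_rate γ hgt).comp (by fun_prop)).mul (by fun_prop)
  have hs2 : MeasurableSet {q : (E × ℝ) × (E × ℝ) | q.2.2 ≤ s - q.1.2} :=
    measurableSet_le (by fun_prop) (by fun_prop)
  have h1 := hY.setLIntegral_step hgt hX hτ k MeasurableSet.univ hm1
  have h2 := hY.setLIntegral_step hgt hX hτ k MeasurableSet.univ
    ((measurable_one (α := ℝ≥0∞)).indicator hs2)
  simp only [Measure.restrict_univ] at h1 h2
  calc _ = ∫⁻ ω, rate γ t g (X k ω) *
        ENNReal.ofReal (min (s - jumpTime τ k ω) (τ (k + 1) ω)) ∂P := by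
        refine lintegral_congr fun ω => ?_
        congr 1
        rw [← ENNReal.ofReal_coe_nnreal, coe_sojourn, ENNReal.ofReal_max]
        simp
    _ = ∫⁻ ω, ∫⁻ z, {q : (E × ℝ) × (E × ℝ) | q.2.2 ≤ s - q.1.2}.indicator 1
          ((X k ω, (jumpTime τ k ω : ℝ)), z) ∂(stepKernel γ hgt (X k ω)) ∂P := by
        rw [h1]
        refine lintegral_congr_ae ?_
        filter_upwards [hgood] with ω ⟨h0, htop⟩
        have hr := ENNReal.toReal_pos h0 htop
        have := isProbabilityMeasure_jumpLaw hgt h0 htop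
        have := isProbabilityMeasure_expMeasure hr
        have e1 : ∀ z, {q : (E × ℝ) × (E × ℝ) | q.2.2 ≤ s - q.1.2}.indicator
            (1 : (E × ℝ) × (E × ℝ) → ℝ≥0∞) ((X k ω, (jumpTime τ k ω : ℝ)), z) =
            (Set.univ ×ˢ Set.Iic ((s : ℝ) - jumpTime τ k ω)).indicator 1 z := by
          intro z
          simp [Set.indicator_apply]
        simp only [e1]
        rw [lintegral_indicator_one (MeasurableSet.univ.prod measurableSet_Iic),
          stepKernel_apply_prod, measure_univ, one_mul, ← mul_lintegral_min_expMeasure hr,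
          lintegral_const_mul _ (by fun_prop), ENNReal.ofReal_toReal htop, stepKernel_apply,
          lintegral_prod _ (by fun_prop)]
        simp only [lintegral_const, measure_univ, mul_one]
    _ = ∫⁻ ω, {ω | jumpTime τ (k + 1) ω ≤ s}.indicator 1 ω ∂P := by
        rw [← h2]
        refine lintegral_congr fun ω => ?_
        simp only [Set.indicator_apply, Set.mem_ofPred_eq, jumpTime_succ, ← NNReal.coe_le_coe,
          NNReal.coe_add, le_sub_iff_add_le', Pi.one_apply]
    _ = _ := lintegral_indicator_one (measurableSet_le (measurable_jumpTime hτ _) measurable_const)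

theorem IsLBMJP.setIntegral_step (n : ℕ) {B : Set Ω} (hB : MeasurableSet[history X τ n] B)
    {φ : (E × ℝ) × (E × ℝ) → ℝ} (hφ : Measurable φ)
    (hint : Integrable
      (fun ω => φ ((X n ω, (jumpTime τ n ω : ℝ)), (X (n + 1) ω, (τ (n + 1) ω : ℝ)))) P) :
    ∫ ω in B, φ ((X n ω, (jumpTime τ n ω : ℝ)), (X (n + 1) ω, (τ (n + 1) ω : ℝ))) ∂P =
      ∫ ω in B, ∫ z, φ ((X n ω, (jumpTime τ n ω : ℝ)), z) ∂(stepKernel γ hgt (X n ω)) ∂P := by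
  have := hY.prob
  have hT : Measurable fun ω => (jumpTime τ n ω : ℝ) :=
    (measurable_jumpTime hτ n).coe_nnreal_real
  have hZ : Measurable fun ω => (X (n + 1) ω, (τ (n + 1) ω : ℝ)) :=
    (hX _).prodMk (hτ _).coe_nnreal_real
  have hW : Measurable fun ω => (X n ω, (jumpTime τ n ω : ℝ)) := (hX _).prodMk hT
  have hmap := hY.map_step hgt hX hτ n hB
  have hint' := (integrable_map_measure (μ := P.restrict B) hφ.aestronglyMeasurable
    (hW.prodMk hZ).aemeasurable).2 hint.integrableOn
  rw [hmap] at hint'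
  have h1 := integral_map (μ := P.restrict B) (hW.prodMk hZ).aemeasurable
    hφ.aestronglyMeasurable
  rw [hmap, Measure.integral_compProd hint', integral_map hW.aemeasurable
    hφ.stronglyMeasurable.integral_kernel_prod_right'.aestronglyMeasurable] at h1
  exact h1.symm

/-- The jump is at most $2C$ in size and $|Lf|\le 2C\lambda$; by the compensator identity both parts
have the same bound, whence the factor 2. -/
theorem IsLBMJP.lintegral_enorm_martIncr_le {C : ℝ} (hC : ∀ y, |f y| ≤ C)
    (s : ℝ≥0) (k : ℕ) (hgood : ∀ᵐ ω ∂P, rate γ t g (X k ω) ≠ 0 ∧ rate γ t g (X k ω) ≠ ∞) :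
    ∫⁻ ω, ‖martIncr X τ f (genL γ t g f) s k ω‖ₑ ∂P ≤
      2 * ENNReal.ofReal (2 * C) * P {ω | jumpTime τ (k + 1) ω ≤ s} := by
  have hm : MeasurableSet {ω | jumpTime τ (k + 1) ω ≤ s} :=
    measurableSet_le (measurable_jumpTime hτ _) measurable_const
  have hm1 : Measurable fun ω => ENNReal.ofReal (2 * C) *
      {ω | jumpTime τ (k + 1) ω ≤ s}.indicator (1 : Ω → ℝ≥0∞) ω :=
    (measurable_one.indicator hm).const_mul _
  have hm2 : Measurable fun ω => rate γ t g (X k ω) *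
      (min s (jumpTime τ (k + 1) ω) - jumpTime τ k ω : ℝ≥0) :=
    ((measurable_rate γ hgt).comp (hX k)).mul
      ((measurable_const.min (measurable_jumpTime hτ _)).sub
        (measurable_jumpTime hτ _)).coe_nnreal_ennreal
  calc ∫⁻ ω, ‖martIncr X τ f (genL γ t g f) s k ω‖ₑ ∂P
      ≤ ∫⁻ ω, (ENNReal.ofReal (2 * C) * {ω | jumpTime τ (k + 1) ω ≤ s}.indicator 1 ω +
          ENNReal.ofReal (2 * C) * (rate γ t g (X k ω) *
            (min s (jumpTime τ (k + 1) ω) - jumpTime τ k ω : ℝ≥0))) ∂P := by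
        refine lintegral_mono fun ω => ?_
        rw [martIncr]
        refine (enorm_sub_le).trans (add_le_add ?_ ?_)
        · rw [enorm_mul, Real.enorm_eq_ofReal_abs]
          refine mul_le_mul' (ENNReal.ofReal_le_ofReal ?_) ?_
          · have := abs_sub (f (X (k + 1) ω)) (f (X k ω))
            linarith [hC (X (k + 1) ω), hC (X k ω)]
          · by_cases h : ω ∈ {ω | jumpTime τ (k + 1) ω ≤ s}
            · rw [Set.indicator_of_mem h, Set.indicator_of_mem h]
              simp
            · rw [Set.indicator_of_notMem h, Set.indicator_of_notMem h]
              simp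
        · rw [enorm_mul, ← mul_assoc, Real.enorm_eq_ofReal (NNReal.coe_nonneg _),
            ENNReal.ofReal_coe_nnreal]
          exact mul_le_mul' (enorm_genL_le hgt hC _) le_rfl
    _ = _ := by
        rw [lintegral_add_left hm1, lintegral_const_mul _ (measurable_one.indicator hm),
          lintegral_indicator_one hm, lintegral_const_mul _ hm2,
          hY.lintegral_rate_mul_sojourn hgt hX hτ s k hgood]
        ring

omit hgt hY [IsSFiniteKernel γ] in
theorem measurable_martIncr {h : E → ℝ} (hf : Measurable f) (hh : Measurable h) (s : ℝ≥0) (k : ℕ) :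
    Measurable (martIncr X τ f h s k) :=
  (((hf.comp (hX _)).sub (hf.comp (hX _))).mul (measurable_one.indicator
    (measurableSet_le (measurable_jumpTime hτ _) measurable_const))).sub
    ((hh.comp (hX _)).mul ((measurable_const.min (measurable_jumpTime hτ _)).sub
        (measurable_jumpTime hτ _)).coe_nnreal_real)

theorem IsLBMJP.integrable_martIncr (hf : Measurable f) {C : ℝ} (hC : ∀ y, |f y| ≤ C)
    (s : ℝ≥0) (k : ℕ) (hgood : ∀ᵐ ω ∂P, rate γ t g (X k ω) ≠ 0 ∧ rate γ t g (X k ω) ≠ ∞) :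
    Integrable (martIncr X τ f (genL γ t g f) s k) P := by
  have := hY.prob
  refine ⟨(measurable_martIncr hX hτ hf (measurable_genL hgt hf) s k).aestronglyMeasurable, ?_⟩
  refine (hY.lintegral_enorm_martIncr_le hgt hX hτ hC s k hgood).trans_lt ?_
  exact ENNReal.mul_lt_top (ENNReal.mul_lt_top (by simp) ENNReal.ofReal_lt_top) (measure_lt_top _ _)

theorem IsLBMJP.setIntegral_martIncr (hf : Measurable f) {C : ℝ} (hC : ∀ y, |f y| ≤ C)
    (s : ℝ≥0) (k : ℕ) (hgood : ∀ᵐ ω ∂P, rate γ t g (X k ω) ≠ 0 ∧ rate γ t g (X k ω) ≠ ∞)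
    {B : Set Ω} (hB : MeasurableSet[history X τ k] B) :
    ∫ ω in B, martIncr X τ f (genL γ t g f) s k ω ∂P = 0 := by
  have hL : Measurable (genL γ t g f) := measurable_genL hgt hf
  set φ : (E × ℝ) × (E × ℝ) → ℝ := fun q =>
    (f q.2.1 - f q.1.1) * {q : (E × ℝ) × (E × ℝ) | q.2.2 ≤ s - q.1.2}.indicator 1 q -
      genL γ t g f q.1.1 * max (min (s - q.1.2) q.2.2) 0 with hφ
  have hs2 : MeasurableSet {q : (E × ℝ) × (E × ℝ) | q.2.2 ≤ s - q.1.2} :=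
    measurableSet_le (by fun_prop) (by fun_prop)
  have hφm : Measurable φ :=
    (((hf.comp (by fun_prop)).sub (hf.comp (by fun_prop))).mul (measurable_one.indicator hs2)).sub
      ((hL.comp (by fun_prop)).mul (by fun_prop))
  have heq : ∀ ω, martIncr X τ f (genL γ t g f) s k ω =
      φ ((X k ω, (jumpTime τ k ω : ℝ)), (X (k + 1) ω, (τ (k + 1) ω : ℝ))) := by
    intro ω
    rw [martIncr, coe_sojourn, hφ]
    simp only [Set.indicator_apply, Set.mem_ofPred_eq, jumpTime_succ, ← NNReal.coe_le_coe,
      NNReal.coe_add, le_sub_iff_add_le', Pi.one_apply]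
  have hint := hY.integrable_martIncr hgt hX hτ hf hC s k hgood
  simp only [heq]
  rw [hY.setIntegral_step hgt hX hτ k hB hφm
    ((integrable_congr (Filter.Eventually.of_forall heq)).1 hint)]
  refine integral_eq_zero_of_ae ?_
  filter_upwards [ae_restrict_of_ae hgood] with ω ⟨h0, htop⟩
  have hr := ENNReal.toReal_pos h0 htop
  have := isProbabilityMeasure_jumpLaw hgt h0 htop
  have := isProbabilityMeasure_expMeasure hr
  set b : ℝ := s - jumpTime τ k ω with hb
  have hφz : ∀ z : E × ℝ, φ ((X k ω, (jumpTime τ k ω : ℝ)), z) =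
      (f z.1 - f (X k ω)) * (Set.Iic b).indicator 1 z.2 -
        genL γ t g f (X k ω) * max (min b z.2) 0 := fun z => rfl
  have hi1 : Integrable (fun z : E × ℝ => (f z.1 - f (X k ω)) *
      (Set.Iic b).indicator (1 : ℝ → ℝ) z.2) ((jumpLaw γ t g (X k ω)).prod
        (expMeasure (rate γ t g (X k ω)).toReal)) := by
    refine Integrable.mul_prod (f := fun y => f y - f (X k ω)) (g := (Set.Iic b).indicator 1) ?_
      ((integrable_const (1 : ℝ)).indicator measurableSet_Iic)
    refine Integrable.sub (Integrable.of_bound hf.aestronglyMeasurable C ?_) (integrable_const _)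
    exact Filter.Eventually.of_forall hC
  have hi2 : Integrable (fun z : E × ℝ => genL γ t g f (X k ω) * max (min b z.2) 0)
      ((jumpLaw γ t g (X k ω)).prod (expMeasure (rate γ t g (X k ω)).toReal)) := by
    refine Integrable.mul_prod (f := fun _ : E => genL γ t g f (X k ω)) (integrable_const _)
      (g := fun q : ℝ => max (min b q) 0)
      (Integrable.of_bound (f := fun q : ℝ => max (min b q) 0) (by fun_prop) |b| ?_)
    refine Filter.Eventually.of_forall fun q => ?_
    rw [Real.norm_of_nonneg (le_max_right _ _)]
    exact max_le ((min_le_left _ _).trans (le_abs_self b)) (abs_nonneg b)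
  -- State and holding time are independent under the step law, so both terms factor, into
  -- $(\lambda^{-1}Lf)\cdot F(b)$ and $Lf\cdot(\lambda^{-1}F(b))$, and cancel.
  simp only [hφz, stepKernel_apply, Pi.zero_apply]
  rw [integral_sub hi1 hi2, integral_prod_mul (fun y => f y - f (X k ω)) ((Set.Iic b).indicator 1),
    integral_prod_mul (fun _ : E => genL γ t g f (X k ω)) (fun q => max (min b q) 0),
    integral_jumpLaw_sub hgt _ h0, integral_min_expMeasure hr,
    integral_indicator_one measurableSet_Iic,
    integral_const, probReal_univ, smul_eq_mul]
  ring

end Increments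

/-! ### The operator `genL` solves the martingale problem -/

section ForwardMartingale

variable {E Ω : Type*} [MeasurableSpace E] [mΩ : MeasurableSpace Ω] {γ : Kernel E E}
  {t : E → E → ℝ≥0} {g : ℝ≥0 → ℝ≥0}
  {x : E} {P : Measure Ω} {X : ℕ → Ω → E} {τ : ℕ → Ω → ℝ≥0} {f : E → ℝ}

theorem ae_forall_exists_lt_jumpTime (hτ : ∀ n, Measurable (τ n))
    (hfin : ∀ s : ℝ≥0, 0 < s → ∫⁻ ω, (numJumps τ s ω : ℝ≥0∞) ∂P < ∞) :
    ∀ᵐ ω ∂P, ∀ s : ℝ≥0, ∃ m, s < jumpTime τ m ω := by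
  have h : ∀ᵐ ω ∂P, ∀ k : ℕ, (numJumps τ ((k : ℝ≥0) + 1) ω : ℝ≥0∞) < ∞ := by
    refine ae_all_iff.2 fun k => ae_lt_top ?_ (hfin _ (by positivity)).ne
    exact (measurable_of_countable _).comp (measurable_numJumps hτ _)
  filter_upwards [h] with ω hω s
  obtain ⟨k, hk⟩ := exists_nat_ge s
  obtain ⟨m, hm⟩ := exists_lt_jumpTime_of_numJumps_ne_top (τ := τ) (s := (k : ℝ≥0) + 1) (ω := ω)
    fun hc => by simpa [hc] using hω k
  exact ⟨m, (hk.trans (by simp)).trans_lt hm⟩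

theorem tsum_measure_jumpTime_le_lt_top (hτ : ∀ n, Measurable (τ n))
    (hfin : ∀ s : ℝ≥0, 0 < s → ∫⁻ ω, (numJumps τ s ω : ℝ≥0∞) ∂P < ∞) (s : ℝ≥0) :
    ∑' k, P {ω | jumpTime τ (k + 1) ω ≤ s} < ∞ := by
  -- Passing to $s+1$ covers $s=0$, as `hfin` speaks of positive times only.
  refine lt_of_le_of_lt (ENNReal.tsum_le_tsum fun k => measure_mono fun ω hω => ?_)
    (lintegral_numJumps (P := P) hτ (s + 1) ▸ hfin (s + 1) (by positivity))
  have hω' : jumpTime τ (k + 1) ω ≤ s := hω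
  exact hω'.trans le_self_add

variable [IsSFiniteKernel γ] (hgt : Measurable fun p : E × E => g (t p.1 p.2))
  (hX : ∀ n, Measurable (X n)) (hτ : ∀ n, Measurable (τ n)) (hY : IsLBMJP γ t g x P X τ)
  (hgood : ∀ᵐ ω ∂P, ∀ n, rate γ t g (X n ω) ≠ 0 ∧ rate γ t g (X n ω) ≠ ∞)
  (hfin : ∀ s : ℝ≥0, 0 < s → ∫⁻ ω, (numJumps τ s ω : ℝ≥0∞) ∂P < ∞)
  (hf : Measurable f) {C : ℝ} (hC : ∀ y, |f y| ≤ C)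
include hgt hX hτ hY hgood hfin hC

theorem IsLBMJP.tsum_lintegral_enorm_martIncr_lt_top (s : ℝ≥0) :
    ∑' k, ∫⁻ ω, ‖martIncr X τ f (genL γ t g f) s k ω‖ₑ ∂P < ∞ := by
  have hgood' := ae_all_iff.1 hgood
  refine (ENNReal.tsum_le_tsum fun k =>
    hY.lintegral_enorm_martIncr_le hgt hX hτ hC s k (hgood' k)).trans_lt ?_
  rw [ENNReal.tsum_mul_left]
  exact ENNReal.mul_lt_top (ENNReal.mul_lt_top (by simp) ENNReal.ofReal_lt_top)
    (tsum_measure_jumpTime_le_lt_top hτ hfin s)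

omit hgt hX hgood hC [IsSFiniteKernel γ] in
theorem IsLBMJP.mart_ae_eq_tsum (h : E → ℝ) (s : ℝ≥0) :
    mart X τ f h x s =ᵐ[P] fun ω => ∑' k, martIncr X τ f h s k ω := by
  filter_upwards [hY.start, ae_forall_exists_lt_jumpTime hτ hfin] with ω h0 hω
  obtain ⟨m, hm⟩ := hω s
  rw [← h0, mart_eq_tsum_martIncr f h hm]

include hf

theorem IsLBMJP.integrable_mart (s : ℝ≥0) : Integrable (mart X τ f (genL γ t g f) x s) P := by
  refine ⟨((stronglyMeasurable_mart hX hτ hf (measurable_genL hgt hf) x s).mono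
    ((natFiltration hX hτ).le s)).aestronglyMeasurable, ?_⟩
  refine lt_of_le_of_lt ?_
    (hY.tsum_lintegral_enorm_martIncr_lt_top hgt hX hτ hgood hfin hC s)
  rw [← lintegral_tsum fun k =>
    (measurable_martIncr hX hτ hf (measurable_genL hgt hf) s k).enorm.aemeasurable]
  refine lintegral_mono_ae ?_
  filter_upwards [hY.mart_ae_eq_tsum hτ hfin (f := f) (genL γ t g f) s] with ω hω
  rw [hω]
  exact enorm_tsum_le_tsum_enorm

theorem IsLBMJP.setIntegral_mart (s : ℝ≥0) (A : Set Ω) :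
    ∫ ω in A, mart X τ f (genL γ t g f) x s ω ∂P =
      ∑' k, ∫ ω in A, martIncr X τ f (genL γ t g f) s k ω ∂P := by
  have hgood' := ae_all_iff.1 hgood
  have hm : ∀ k, Measurable (martIncr X τ f (genL γ t g f) s k) :=
    measurable_martIncr hX hτ hf (measurable_genL hgt hf) s
  rw [integral_congr_ae (ae_restrict_of_ae (hY.mart_ae_eq_tsum hτ hfin (f := f) _ s)),
    integral_tsum fun k => (hm k).aestronglyMeasurable]
  refine ((ENNReal.tsum_le_tsum fun k => ?_).trans_lt
    (hY.tsum_lintegral_enorm_martIncr_lt_top hgt hX hτ hgood hfin hC s)).ne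
  exact lintegral_mono' Measure.restrict_le_self le_rfl

theorem IsLBMJP.solvesMartingale_genL : SolvesMartingale hX hτ P f (genL γ t g f) x := by
  have := hY.prob
  have hgood' := ae_all_iff.1 hgood
  have hL : Measurable (genL γ t g f) := measurable_genL hgt hf
  have hsm := stronglyMeasurable_mart hX hτ hf hL x
  have hint := hY.integrable_mart hgt hX hτ hgood hfin hf hC
  refine ⟨?_, hsm, fun u s hus => ?_⟩
  · filter_upwards [ae_forall_exists_lt_jumpTime hτ hfin] with ω hω s
    obtain ⟨m, hm⟩ := hω s
    exact intervalIntegrable_extend_proc X _ hm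
  refine (ae_eq_condExp_of_forall_setIntegral_eq ((natFiltration hX hτ).le u) (hint s)
    (fun A _ _ => (hint u).integrableOn) (fun A hA _ => ?_) (hsm u).aestronglyMeasurable).symm
  rw [hY.setIntegral_mart hgt hX hτ hgood hfin hf hC,
    hY.setIntegral_mart hgt hX hτ hgood hfin hf hC]
  refine tsum_congr fun k => ?_
  have hAm := (natFiltration hX hτ).le u A hA
  -- $A$ is replaced by an event $B$ of the first $k$ jumps, over which contribution $k$ integrates
  -- to zero at both times. The replacement costs nothing: $A$ and $B$ agree on $\{T_{k+1}>u\}$, and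
  -- elsewhere the difference of the two contributions vanishes.
  obtain ⟨B, hB, hAB⟩ := natFiltration_le_pastEvents hX hτ u k A hA
  have hBm := history_le hX hτ k B hB
  have hi := fun v => hY.integrable_martIncr hgt hX hτ hf hC v k (hgood' k)
  have key : ∀ D : Set Ω, MeasurableSet D →
      ∫ ω in D, martIncr X τ f (genL γ t g f) s k ω ∂P -
        ∫ ω in D, martIncr X τ f (genL γ t g f) u k ω ∂P =
      ∫ ω, D.indicator (fun ω => martIncr X τ f (genL γ t g f) s k ω -
        martIncr X τ f (genL γ t g f) u k ω) ω ∂P := by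
    intro D hD
    rw [integral_indicator hD, integral_sub (hi s).integrableOn (hi u).integrableOn]
  have hzero := key B hBm
  rw [hY.setIntegral_martIncr hgt hX hτ hf hC s k (hgood' k) hB,
    hY.setIntegral_martIncr hgt hX hτ hf hC u k (hgood' k) hB, sub_zero] at hzero
  refine (sub_eq_zero.1 ?_).symm
  rw [key A hAm, hzero]
  refine integral_congr_ae (Filter.Eventually.of_forall fun ω => ?_)
  by_cases hω : u < jumpTime τ (k + 1) ω
  · by_cases hA' : ω ∈ A
    · rw [Set.indicator_of_mem hA', Set.indicator_of_mem ((hAB ω hω).1 hA')]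
    · rw [Set.indicator_of_notMem hA', Set.indicator_of_notMem fun h => hA' ((hAB ω hω).2 h)]
  · have h0 : martIncr X τ f (genL γ t g f) s k ω - martIncr X τ f (genL γ t g f) u k ω = 0 :=
      sub_eq_zero.2 (martIncr_eq_of_jumpTime_le f _ hus (not_lt.1 hω))
    have h1 : ∀ D : Set Ω, D.indicator (fun ω => martIncr X τ f (genL γ t g f) s k ω -
        martIncr X τ f (genL γ t g f) u k ω) ω = 0 :=
      fun D => Set.indicator_apply_eq_zero.2 fun _ => h0
    rw [h1, h1]

end ForwardMartingale

/-! ### Optional stopping at the exit from the starting point -/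

section Exit

open Filter Topology

/-- The grid approximations of the exit time from `y₀`, capped at `1`, converge. -/
theorem exists_tendsto_grid_exit {β : Type*} {y : ℝ≥0 → β}
    (hright : ∀ r, ∃ b, r < b ∧ ∀ q, r ≤ q → q < b → y q = y r) {y₀ : β} (h0 : y 0 = y₀)
    {σ : ℕ → ℕ} (hbefore : ∀ n, ∀ j < σ n, j < n + 1 ∧ y ((j : ℝ≥0) / (n + 1)) = y₀)
    (hat : ∀ n, n + 1 ≤ σ n ∨ y ((σ n : ℝ≥0) / (n + 1)) ≠ y₀) :
    ∃ ρ : ℝ≥0, 0 < ρ ∧ ρ ≤ 1 ∧ (∀ r < ρ, y r = y₀) ∧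
      Tendsto (fun n => (σ n : ℝ≥0) / (n + 1)) atTop (𝓝 ρ) := by
  set A : Set ℝ≥0 := {r | 1 ≤ r ∨ y r ≠ y₀} with hA
  have hone : (1 : ℝ≥0) ∈ A := Or.inl le_rfl
  have hbdd : BddBelow A := OrderBot.bddBelow A
  set ρ := sInf A with hρ
  have hlt : ∀ r < ρ, r < 1 ∧ y r = y₀ := fun r hr => by
    have := notMem_of_lt_csInf hr hbdd
    simpa [hA] using this
  have hpos : 0 < ρ := by
    obtain ⟨b, hb, hconst⟩ := hright 0
    refine lt_of_lt_of_le (lt_min hb one_pos) (le_csInf ⟨1, hone⟩ fun r hr => ?_)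
    rcases hr with hr | hr
    · exact (min_le_right _ _).trans hr
    · refine (min_le_left _ _).trans (not_lt.1 fun hc => hr ?_)
      rw [hconst r zero_le hc, h0]
  have hle : ρ ≤ 1 := csInf_le hbdd hone
  -- Right-continuity makes all times just after $\rho$ exit times, so for large $n$ the first grid
  -- point at or after $\rho$ already stops $\sigma_n$. This squeezes $\sigma_n/(n+1)$ between
  -- $\rho$ and that grid point.
  have hnear : ∃ b, ρ < b ∧ ∀ r, ρ ≤ r → r < b → r ∈ A := by
    rcases hle.lt_or_eq with hlt1 | heq
    · obtain ⟨b, hb, hconst⟩ := hright ρ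
      refine ⟨b, hb, fun r hr hrb => Or.inr ?_⟩
      rw [hconst r hr hrb]
      intro hy
      refine absurd (le_csInf ⟨1, hone⟩ fun q hq => ?_) (not_le.2 (lt_min hb hlt1))
      rcases hq with hq' | hq'
      · exact (min_le_right _ _).trans hq'
      · refine (min_le_left _ _).trans (not_lt.1 fun hc => hq' ?_)
        rw [hconst q (csInf_le hbdd (Or.inr hq')) hc, hy]
    · exact ⟨ρ + 1, by simp, fun r hr _ => Or.inl (heq ▸ hr)⟩
  refine ⟨ρ, hpos, hle, fun r hr => (hlt r hr).2, ?_⟩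
  obtain ⟨b, hb, hnearA⟩ := hnear
  have hceil := tendsto_ceil_div ρ
  refine tendsto_of_tendsto_of_tendsto_of_le_of_le' tendsto_const_nhds hceil
    (Eventually.of_forall fun n => csInf_le hbdd ?_) ?_
  · refine (hat n).imp_left fun h => ?_
    rw [one_le_div (by positivity)]
    exact_mod_cast h
  · filter_upwards [hceil.eventually (gt_mem_nhds hb)] with n hn
    have hmem := hnearA _ (le_ceil_div ρ n) hn
    have hσ : σ n ≤ ⌈ρ * (n + 1)⌉₊ := by
      by_contra hc
      obtain ⟨h1, h2⟩ := hbefore n _ (not_le.1 hc)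
      refine hmem.elim (fun h => ?_) fun h => h h2
      rw [one_le_div (by positivity)] at h
      have h' : n + 1 ≤ ⌈ρ * (n + 1)⌉₊ := by exact_mod_cast h
      omega
    gcongr

variable {Ω β : Type*} {mΩ : MeasurableSpace Ω} {P : Measure Ω} [IsProbabilityMeasure P]
  [MeasurableSpace β]

/-- If the additive functional `∫₀ˢ k(Y_r) dr` of a process with right-continuous paths for the
discrete topology is a martingale, then `k` vanishes at the starting point. -/
theorem eq_zero_of_martingale_integral {ℱ : Filtration ℝ≥0 mΩ} {Y : ℝ≥0 → Ω → β}
    {N : ℝ≥0 → Ω → ℝ} {k : β → ℝ} {y₀ : β} (hy₀ : MeasurableSet {y₀})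
    (hright : ∀ ω r, ∃ b, r < b ∧ ∀ q, r ≤ q → q < b → Y q ω = Y r ω)
    (hYm : ∀ r, Measurable[ℱ r] (Y r)) (hN : Martingale N ℱ P) (hstart : ∀ᵐ ω ∂P, Y 0 ω = y₀)
    (hint : ∀ᵐ ω ∂P, IntervalIntegrable (fun r : ℝ => k (Y r.toNNReal ω)) volume 0 1)
    (hNk : ∀ᵐ ω ∂P, ∀ s : ℝ≥0, N s ω = ∫ r in (0 : ℝ)..s, k (Y r.toNNReal ω)) : k y₀ = 0 := by
  classical
  have hex : ∀ (n : ℕ) (ω : Ω), ∃ i : ℕ, n + 1 ≤ i ∨ Y ((i : ℝ≥0) / (n + 1)) ω ≠ y₀ :=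
    fun n ω => ⟨n + 1, Or.inl le_rfl⟩
  set σ : ℕ → Ω → ℕ := fun n ω => Nat.find (hex n ω) with hσ
  have hbefore : ∀ n ω, ∀ j < σ n ω, j < n + 1 ∧ Y ((j : ℝ≥0) / (n + 1)) ω = y₀ := by
    intro n ω j hj
    simpa using Nat.find_min (hex n ω) hj
  have hat : ∀ n ω, n + 1 ≤ σ n ω ∨ Y ((σ n ω : ℝ≥0) / (n + 1)) ω ≠ y₀ :=
    fun n ω => Nat.find_spec (hex n ω)
  have hσle : ∀ n ω, σ n ω ≤ n + 1 := fun n ω => Nat.find_min' _ (Or.inl le_rfl)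
  have hσm : ∀ (n i : ℕ), MeasurableSet[ℱ ((i : ℝ≥0) / (n + 1))] {ω | σ n ω = i} := by
    intro n i
    have hY' : ∀ j ≤ i, MeasurableSet[ℱ ((i : ℝ≥0) / (n + 1))]
        {ω | n + 1 ≤ j ∨ Y ((j : ℝ≥0) / (n + 1)) ω ≠ y₀} := by
      intro j hj
      have hmono : (j : ℝ≥0) / (n + 1) ≤ (i : ℝ≥0) / (n + 1) := by gcongr
      exact (MeasurableSet.const (n + 1 ≤ j)).union
        (ℱ.mono hmono _ (hYm _ hy₀)).compl
    have : {ω | σ n ω = i} = {ω | n + 1 ≤ i ∨ Y ((i : ℝ≥0) / (n + 1)) ω ≠ y₀} ∩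
        ⋂ j ∈ Set.Iio i, {ω | n + 1 ≤ j ∨ Y ((j : ℝ≥0) / (n + 1)) ω ≠ y₀}ᶜ := by
      ext ω
      simp only [hσ, Set.mem_ofPred_eq, Nat.find_eq_iff, Set.mem_inter_iff, Set.mem_iInter,
        Set.mem_compl_iff, Set.mem_Iio]
    rw [this]
    exact (hY' i le_rfl).inter (MeasurableSet.biInter (Set.to_countable _)
      fun j hj => (hY' j (le_of_lt hj)).compl)
  have hσmeas : ∀ n, Measurable (σ n) := fun n =>
    measurable_to_countable' fun i => ℱ.le _ _ (hσm n i)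
  set U : ℕ → Ω → ℝ≥0 := fun n ω => (σ n ω : ℝ≥0) / (n + 1) with hU
  have hUle : ∀ n ω, U n ω ≤ 1 := fun n ω => by
    rw [hU]
    dsimp only
    rw [div_le_one (by positivity)]
    exact_mod_cast hσle n ω
  have hUm : ∀ n, Measurable (U n) := fun n =>
    (measurable_of_countable fun i : ℕ => (i : ℝ≥0) / (n + 1)).comp (hσmeas n)
  set Z : ℕ → Ω → ℝ := fun n ω => N (U n ω) ω with hZ
  have hNm : ∀ s, Measurable (N s) := fun s =>
    ((hN.1 s).mono (ℱ.le s)).measurable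
  have hZm : ∀ n, Measurable (Z n) := by
    intro n
    have h : Measurable fun p : ℕ × Ω => N ((p.1 : ℝ≥0) / (n + 1)) p.2 :=
      measurable_from_prod_countable_right fun i => hNm ((i : ℝ≥0) / (n + 1))
    exact h.comp ((hσmeas n).prodMk measurable_id)
  have hNint : ∀ s, Integrable (N s) P := hN.integrable
  -- Optional stopping for a time with finitely many values, restricted to an event known at that
  -- time. The truncation provides a bound uniform in $n$; no integrability of $k$ under the law of
  -- $Y$ is available.
  have hoptional : ∀ (n : ℕ) (M : ℝ), ∫ ω in {ω | |Z n ω| ≤ M}, Z n ω ∂P =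
      ∫ ω in {ω | |Z n ω| ≤ M}, N 1 ω ∂P := by
    intro n M
    set G : ℕ → Set Ω := fun i =>
      {ω | σ n ω = i} ∩ {ω | |N ((i : ℝ≥0) / (n + 1)) ω| ≤ M} with hG
    have hGm : ∀ i : ℕ, MeasurableSet[ℱ ((i : ℝ≥0) / (n + 1))] (G i) := fun i =>
      (hσm n i).inter
        ((continuous_abs.measurable.comp (hN.1 _).measurable) measurableSet_Iic)
    have hGm' : ∀ i, MeasurableSet (G i) := fun i => ℱ.le _ _ (hGm i)
    have hZG : ∀ i : ℕ, Set.EqOn (N ((i : ℝ≥0) / (n + 1))) (Z n) (G i) := by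
      rintro i ω ⟨hω, -⟩
      have hω' : σ n ω = i := hω
      simp only [hZ, hU, hω']
    have hD : {ω | |Z n ω| ≤ M} = ⋃ i ∈ Finset.range (n + 2), G i := by
      ext ω
      simp only [hG, hZ, hU, Set.mem_ofPred_eq, Set.mem_iUnion, Finset.mem_range, Set.mem_inter_iff,
        exists_prop]
      constructor
      · intro h
        exact ⟨σ n ω, by have := hσle n ω; omega, rfl, h⟩
      · rintro ⟨i, -, hi, h⟩
        rwa [hi]
    have hdisj : Set.Pairwise (Finset.range (n + 2) : Set ℕ) (Function.onFun Disjoint G) := by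
      intro i _ j _ hij
      refine Set.disjoint_left.2 ?_
      rintro ω ⟨hi, -⟩ ⟨hj, -⟩
      exact hij (Eq.trans (Eq.symm hi) hj)
    rw [hD, integral_biUnion_finset _ (fun i _ => hGm' i) hdisj
        (fun i _ => (hNint _).integrableOn.congr_fun (hZG i) (hGm' i)),
      integral_biUnion_finset _ (fun i _ => hGm' i) hdisj (fun i _ => (hNint _).integrableOn)]
    refine Finset.sum_congr rfl fun i hi => ?_
    have hi1 : (i : ℝ≥0) / (n + 1) ≤ 1 := by
      rw [div_le_one (by positivity)]
      have : i ≤ n + 1 := by simpa [Nat.lt_succ_iff] using Finset.mem_range.1 hi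
      exact_mod_cast this
    rw [← setIntegral_congr_fun (hGm' i) (hZG i), hN.setIntegral_eq hi1 (hGm i)]
  have hN1 : ∫ ω, N 1 ω ∂P = 0 := by
    have h := hN.setIntegral_eq (zero_le (a := (1 : ℝ≥0))) MeasurableSet.univ
    rw [setIntegral_univ, setIntegral_univ] at h
    rw [← h]
    refine integral_eq_zero_of_ae ?_
    filter_upwards [hNk] with ω hω
    simp [hω 0]
  have hpath : ∀ᵐ ω ∂P, ∃ ρ : ℝ≥0, 0 < ρ ∧ ρ ≤ 1 ∧ Tendsto (fun n => U n ω) atTop (𝓝 ρ) ∧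
      Tendsto (fun n => Z n ω) atTop (𝓝 (k y₀ * ρ)) := by
    filter_upwards [hstart, hint, hNk] with ω hω0 hωint hωN
    obtain ⟨ρ, hρ0, hρ1, hρ, hlim⟩ := exists_tendsto_grid_exit (hright ω) hω0
      (σ := fun n => σ n ω) (fun n => hbefore n ω) (fun n => hat n ω)
    refine ⟨ρ, hρ0, hρ1, hlim, ?_⟩
    have hcont := intervalIntegral.continuousOn_primitive_interval
      (μ := volume) (f := fun r : ℝ => k (Y r.toNNReal ω)) (a := 0) (b := 1) (by
        rw [Set.uIcc_of_le zero_le_one, integrableOn_Icc_iff_integrableOn_Ioc,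
          ← intervalIntegrable_iff_integrableOn_Ioc_of_le zero_le_one]
        exact hωint)
    have hval : ∫ r in (0 : ℝ)..ρ, k (Y r.toNNReal ω) = k y₀ * ρ := by
      rw [intervalIntegral.integral_congr_ae (g := fun _ => k y₀)]
      · simp [mul_comm]
      · have hne : ∀ᵐ r : ℝ, r ≠ ρ := by simp [ae_iff]
        filter_upwards [hne] with r hr hmem
        rw [Set.uIoc_of_le ρ.coe_nonneg] at hmem
        have : r.toNNReal < ρ := by
          rw [Real.toNNReal_lt_iff_lt_coe hmem.1.le]
          exact lt_of_le_of_ne hmem.2 hr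
        rw [hρ _ this]
    rw [← hval]
    have hmem : ∀ n, (U n ω : ℝ) ∈ Set.uIcc (0 : ℝ) 1 := fun n => by
      rw [Set.uIcc_of_le zero_le_one]
      exact ⟨NNReal.coe_nonneg _, by exact_mod_cast hUle n ω⟩
    have hρmem : (ρ : ℝ) ∈ Set.uIcc (0 : ℝ) 1 := by
      rw [Set.uIcc_of_le zero_le_one]
      exact ⟨ρ.coe_nonneg, by exact_mod_cast hρ1⟩
    have hlim' : Tendsto (fun n => (U n ω : ℝ)) atTop (𝓝[Set.uIcc (0 : ℝ) 1] ρ) :=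
      tendsto_nhdsWithin_iff.2 ⟨NNReal.tendsto_coe.2 hlim, Eventually.of_forall hmem⟩
    refine ((hcont ρ hρmem).tendsto.comp hlim').congr fun n => ?_
    simp only [hZ, hωN, Function.comp]
  -- The limits are chosen pathwise, with value 0 on the exceptional set; measurability is recovered
  -- afterwards from the almost sure convergence of $U_n$.
  obtain ⟨ρ, hρ⟩ : ∃ ρ : Ω → ℝ≥0, ∀ᵐ ω ∂P, 0 < ρ ω ∧ ρ ω ≤ 1 ∧
      Tendsto (fun n => U n ω) atTop (𝓝 (ρ ω)) ∧
      Tendsto (fun n => Z n ω) atTop (𝓝 (k y₀ * ρ ω)) := by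
    have : ∀ ω, ∃ ρ : ℝ≥0, (∃ ρ : ℝ≥0, 0 < ρ ∧ ρ ≤ 1 ∧ Tendsto (fun n => U n ω) atTop (𝓝 ρ) ∧
      Tendsto (fun n => Z n ω) atTop (𝓝 (k y₀ * ρ))) → (0 < ρ ∧ ρ ≤ 1 ∧
      Tendsto (fun n => U n ω) atTop (𝓝 ρ) ∧
      Tendsto (fun n => Z n ω) atTop (𝓝 (k y₀ * ρ))) := by
      intro ω
      by_cases h : ∃ ρ : ℝ≥0, 0 < ρ ∧ ρ ≤ 1 ∧ Tendsto (fun n => U n ω) atTop (𝓝 ρ) ∧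
        Tendsto (fun n => Z n ω) atTop (𝓝 (k y₀ * ρ))
      · exact ⟨h.choose, fun _ => h.choose_spec⟩
      · exact ⟨0, fun h' => absurd h' h⟩
    choose ρ hρ using this
    exact ⟨ρ, hpath.mono hρ⟩
  have hρm : AEMeasurable ρ P := aemeasurable_of_tendsto_metrizable_ae atTop
    (fun n => (hUm n).aemeasurable) (hρ.mono fun ω h => h.2.2.1)
  -- The limit of $Z_n$ has modulus at most $|k(y_0)|<M$, so the truncation is eventually inactive
  -- on almost every path. Dominated convergence then gives $k(y_0)\,\mathbb E[\rho]=\mathbb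
  -- E[N_1]=0$.
  set M : ℝ := |k y₀| + 1 with hM
  have hev : ∀ᵐ ω ∂P, ∀ᶠ n in atTop, ω ∈ {ω | |Z n ω| ≤ M} := by
    filter_upwards [hρ] with ω ⟨h0, h1, _, h3⟩
    have hlt : |k y₀ * ρ ω| < M := by
      rw [abs_mul, NNReal.abs_eq]
      have : (ρ ω : ℝ) ≤ 1 := by exact_mod_cast h1
      nlinarith [abs_nonneg (k y₀)]
    filter_upwards [h3.abs.eventually (gt_mem_nhds hlt)] with n hn using le_of_lt hn
  have hDm : ∀ n, MeasurableSet {ω | |Z n ω| ≤ M} := fun n => (hZm n).abs measurableSet_Iic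
  have hlim1 : Tendsto (fun n => ∫ ω, {ω | |Z n ω| ≤ M}.indicator (Z n) ω ∂P) atTop
      (𝓝 (∫ ω, k y₀ * ρ ω ∂P)) := by
    refine tendsto_integral_of_dominated_convergence (fun _ => M)
      (fun n => ((hZm n).indicator (hDm n)).aestronglyMeasurable) (integrable_const _)
      (fun n => Eventually.of_forall fun ω => ?_) ?_
    · rw [Set.indicator_apply]
      split_ifs with h
      · exact h
      · rw [norm_zero]
        positivity
    · filter_upwards [hρ, hev] with ω h hω
      refine h.2.2.2.congr' ?_
      filter_upwards [hω] with n hn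
      exact (Set.indicator_of_mem (s := {ω | |Z n ω| ≤ M}) hn _).symm
  have hlim2 : Tendsto (fun n => ∫ ω, {ω | |Z n ω| ≤ M}.indicator (N 1) ω ∂P) atTop
      (𝓝 (∫ ω, N 1 ω ∂P)) := by
    refine tendsto_integral_of_dominated_convergence (fun ω => |N 1 ω|)
      (fun n => ((hNm 1).indicator (hDm n)).aestronglyMeasurable) (hNint 1).abs
      (fun n => Eventually.of_forall fun ω => norm_indicator_le_norm_self _ _) ?_
    filter_upwards [hev] with ω hω
    refine tendsto_const_nhds.congr' ?_
    filter_upwards [hω] with n hn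
    exact (Set.indicator_of_mem (s := {ω | |Z n ω| ≤ M}) hn _).symm
  have heq : ∀ n, ∫ ω, {ω | |Z n ω| ≤ M}.indicator (Z n) ω ∂P =
      ∫ ω, {ω | |Z n ω| ≤ M}.indicator (N 1) ω ∂P := fun n => by
    rw [integral_indicator (hDm n), integral_indicator (hDm n), hoptional n M]
  simp only [heq] at hlim1
  have hfinal := tendsto_nhds_unique hlim1 hlim2
  rw [hN1, integral_const_mul] at hfinal
  refine (mul_eq_zero.1 hfinal).resolve_right (ne_of_gt ?_)
  have hρint : Integrable (fun ω => (ρ ω : ℝ)) P := by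
    refine Integrable.of_bound hρm.coe_nnreal_real.aestronglyMeasurable 1 ?_
    filter_upwards [hρ] with ω h
    rw [Real.norm_of_nonneg (NNReal.coe_nonneg _)]
    exact_mod_cast h.2.1
  rw [integral_pos_iff_support_of_nonneg (fun ω => (ρ ω).coe_nonneg) hρint]
  have hsupp : ∀ᵐ ω ∂P, ω ∈ Function.support fun ω => (ρ ω : ℝ) := by
    filter_upwards [hρ] with ω h
    simpa using h.1.ne'
  have hone : P (Function.support fun ω => (ρ ω : ℝ)) = P Set.univ :=
    measure_congr (eventuallyEq_univ.2 hsupp)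
  rw [hone, measure_univ]
  exact one_pos

end Exit

/-! ### Uniqueness of the second component -/

section Uniqueness

variable {E Ω : Type*} [MeasurableSpace E] [mΩ : MeasurableSpace Ω] {γ : Kernel E E}
  {t : E → E → ℝ≥0} {g : ℝ≥0 → ℝ≥0}
  {x : E} {P : Measure Ω} {X : ℕ → Ω → E} {τ : ℕ → Ω → ℝ≥0}
  (hX : ∀ n, Measurable (X n)) (hτ : ∀ n, Measurable (τ n))

theorem expMeasure_Iic_zero {r : ℝ} (hr : 0 ≤ r) : expMeasure r (Set.Iic 0) = 0 := by
  rcases hr.eq_or_lt with rfl | hr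
  · simp [expMeasure_zero]
  · simp [expMeasure_Iic hr]

theorem IsLBMJP.ae_hold_pos (hY : IsLBMJP γ t g x P X τ) : ∀ᵐ ω ∂P, 0 < τ 1 ω := by
  have h := hY.holding 1 (fun _ => Set.univ) (fun _ => Set.Iic 0) (fun _ => .univ)
    (fun _ => measurableSet_Iic)
  simp only [Finset.Icc_self, Finset.prod_singleton, Finset.mem_singleton, forall_eq,
    expMeasure_Iic_zero ENNReal.toReal_nonneg, lintegral_zero, Set.mem_univ, implies_true,
    true_and] at h
  rw [ae_iff, ← h]
  congr 1
  ext ω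
  simp only [Set.mem_ofPred_eq, not_lt, Set.mem_Iic]
  exact_mod_cast Iff.rfl

theorem IsLBMJP.ae_proc_zero (hY : IsLBMJP γ t g x P X τ) :
    ∀ᵐ ω ∂P, proc X τ 0 ω = Sum.inl x := by
  filter_upwards [hY.start, hY.ae_hold_pos] with ω h0 h1
  rw [← h0]
  refine proc_eq (jumpTime_zero τ ω).le ?_
  rw [jumpTime_succ, jumpTime_zero, zero_add]
  exact h1

omit [MeasurableSpace E] mΩ in
theorem extend_proc_congr {f h : E → ℝ} {ω : Ω} (hω : ∀ n, f (X n ω) = h (X n ω)) (s : ℝ≥0) :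
    extend f (proc X τ s ω) = extend h (proc X τ s ω) := by
  rw [proc]
  split_ifs
  · exact hω _
  · rfl

/-- The martingale problem is insensitive to changes of `h` off the range of the chain. -/
theorem SolvesMartingale.congr {f h h' : E → ℝ} (hs : SolvesMartingale hX hτ P f h x)
    (hf : Measurable f) (hh' : Measurable h') (heq : ∀ᵐ ω ∂P, ∀ n, h (X n ω) = h' (X n ω)) :
    SolvesMartingale hX hτ P f h' x := by
  have hmart : ∀ s, mart X τ f h x s =ᵐ[P] mart X τ f h' x s := by
    intro s
    filter_upwards [heq] with ω hω
    simp only [mart, extend_proc_congr hω]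
  refine ⟨?_, stronglyMeasurable_mart hX hτ hf hh' x, fun u s hus => ?_⟩
  · filter_upwards [hs.integrable, heq] with ω h1 hω s
    simpa only [extend_proc_congr hω] using h1 s
  · exact (condExp_congr_ae (hmart s).symm).trans ((hs.martingale.2 u s hus).trans (hmart u))

/-- In the difference of the two martingales $f(Y_s)-f(x)$ cancels, and only
$\int_0^s(h-h')(Y_r)\,dr$ remains. -/
theorem SolvesMartingale.eq_at_start [MeasurableSingletonClass E] {f h h' : E → ℝ}
    (hY : IsLBMJP γ t g x P X τ) (hs : SolvesMartingale hX hτ P f h x)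
    (hs' : SolvesMartingale hX hτ P f h' x) : h x = h' x := by
  have := hY.prob
  have key := eq_zero_of_martingale_integral (P := P) (ℱ := natFiltration hX hτ)
    (Y := proc X τ) (N := mart X τ f h' x - mart X τ f h x)
    (k := fun y => extend h y - extend h' y) (y₀ := Sum.inl x)
    (by rw [← Set.image_singleton]; exact (measurableSet_singleton x).inl_image)
    (fun ω r => exists_proc_eq_on_Ico X τ ω r)
    (fun r => measurable_natFiltration_proc hX hτ le_rfl)
    (hs'.martingale.sub hs.martingale) hY.ae_proc_zero
    (by
      filter_upwards [hs.integrable, hs'.integrable] with ω h1 h2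
      simpa using (h1 1).sub (h2 1))
    (by
      filter_upwards [hs.integrable, hs'.integrable] with ω h1 h2 s
      rw [intervalIntegral.integral_sub (h1 s) (h2 s)]
      simp only [Pi.sub_apply, mart]
      ring)
  exact sub_eq_zero.1 key

end Uniqueness

end LBMJP

/-! ### The weak generator theorem -/

theorem mainTheorem8 {E : Type*} [TopologicalSpace E] [PolishSpace E] [MeasurableSpace E]
    [BorelSpace E] (π : Measure E) [IsProbabilityMeasure π] (γ : Kernel E E) [IsMarkovKernel γ]
    (t : E → E → ℝ≥0) (ht : LBMJP.IsRatio π γ t)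
    (g : ℝ≥0 → ℝ≥0) (hg : LBMJP.IsBalancing g)
    -- the process, started from any `x` in the support of `π` with finite jump rate
    {Ω : Type*} [MeasurableSpace Ω] (P : E → Measure Ω) (X : ℕ → Ω → E) (τ : ℕ → Ω → ℝ≥0)
    (hX : ∀ n, Measurable (X n)) (hτ : ∀ n, Measurable (τ n))
    (hY : ∀ x ∈ π.support, LBMJP.rate γ t g x < ∞ → LBMJP.IsLBMJP γ t g x (P x) X τ)
    -- positive rates
    (h_pos : ∀ x ∈ π.support, 0 < LBMJP.rate γ t g x)
    -- regularity of the balancing function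
    (h_mono : Monotone g) (h_cont : Continuous g)
    -- irreducibility of the embedded chain
    (h_irr : ∃ φ : Measure E, φ ≠ 0 ∧ ∀ x ∈ π.support, LBMJP.rate γ t g x < ∞ →
      ∀ B : Set E, MeasurableSet B → 0 < φ B → ∃ n, 0 < P x {ω | X n ω ∈ B})
    -- null sets are not charged by the jump kernel
    (h_ac : ∀ x ∈ π.support, ∀ A : Set E, MeasurableSet A → π A = 0 →
      LBMJP.jumpLaw γ t g x A = 0) :
    (∀ᵐ x ∂π, x ∈ LBMJP.goodStarts γ t g π P τ) ∧
    (∀ x ∈ LBMJP.goodStarts γ t g π P τ,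
      ∀ f : E → ℝ, Measurable f → (∃ C, ∀ y, |f y| ≤ C) →
        LBMJP.SolvesMartingale hX hτ (P x) f (LBMJP.genL γ t g f) x) ∧
    (∀ f : E → ℝ, Measurable f → (∃ C, ∀ y, |f y| ≤ C) →
      f ∈ LBMJP.weakDomain hX hτ π P ∧
      ∀ h : E → ℝ, Measurable h →
        (LBMJP.IsWeakGenerator hX hτ π P f h ↔ h =ᵐ[π] LBMJP.genL γ t g f)) := by
  have hgt := LBMJP.measurable_balanced_ratio ht h_mono
  have hS : ∀ᵐ x ∂π, x ∈ LBMJP.goodStarts γ t g π P τ :=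
    LBMJP.ae_mem_goodStarts ht hg h_mono hX hτ hY h_pos
  have hsolves : ∀ x ∈ LBMJP.goodStarts γ t g π P τ,
      ∀ f : E → ℝ, Measurable f → (∃ C, ∀ y, |f y| ≤ C) →
        LBMJP.SolvesMartingale hX hτ (P x) f (LBMJP.genL γ t g f) x := by
    rintro x ⟨hx, hxtop, hxfin⟩ f hf ⟨C, hC⟩
    have hYx := hY x hx hxtop
    -- Off this null set rates lie in $(0,\infty)$. A chain started outside it never enters it, so
    -- every rate met along the path is positive and finite.
    have hNm : MeasurableSet ({y | LBMJP.rate γ t g y = ∞} ∪ π.supportᶜ) :=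
      (LBMJP.measurable_rate γ hgt (measurableSet_singleton ∞)).union
        Measure.isClosed_support.measurableSet.compl
    have hN0 : π ({y | LBMJP.rate γ t g y = ∞} ∪ π.supportᶜ) = 0 := by
      refine measure_union_null ?_ Measure.measure_compl_support
      simpa [ae_iff] using LBMJP.ae_rate_lt_top ht hg h_mono
    have hgood : ∀ᵐ ω ∂(P x), ∀ n,
        LBMJP.rate γ t g (X n ω) ≠ 0 ∧ LBMJP.rate γ t g (X n ω) ≠ ∞ := by
      filter_upwards [hYx.ae_notMem_of_null h_ac hx hNm hN0 (by simp [hx, hxtop.ne])] with ω hω n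
      have hn := hω n
      simp only [Set.mem_union, Set.mem_ofPred_eq, Set.mem_compl_iff, not_or, not_not] at hn
      exact ⟨(h_pos _ hn.2).ne', hn.1⟩
    exact hYx.solvesMartingale_genL hgt hX hτ hgood hxfin hf hC
  refine ⟨hS, hsolves, fun f hf hfC => ?_⟩
  have hL : Measurable (LBMJP.genL γ t g f) := LBMJP.measurable_genL hgt hf
  have hgen : LBMJP.IsWeakGenerator hX hτ π P f (LBMJP.genL γ t g f) :=
    ⟨hf, hL, hS.mono fun x hx => hsolves x hx f hf hfC⟩
  refine ⟨⟨_, hgen⟩, fun h hh => ⟨fun hw => ?_, fun heq => ⟨hf, hh, ?_⟩⟩⟩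
  · filter_upwards [hS, hw.solves, hgen.solves] with x hx h1 h2
    exact h1.eq_at_start hX hτ (hY x hx.1 hx.2.1) h2
  -- From a start where $h=Lf$, the chain almost surely avoids the null set where they differ, so
  -- both functions yield the same process.
  · have hNm : MeasurableSet {y | h y ≠ LBMJP.genL γ t g f y} :=
      (measurableSet_eq_fun hh hL).compl
    filter_upwards [hS, heq, hgen.solves] with x hx hxeq hsol
    refine hsol.congr hX hτ hf hh ?_
    filter_upwards [(hY x hx.1 hx.2.1).ae_notMem_of_null h_ac hx.1 hNm heq
      (by simpa using hxeq)] with ω hω n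
    exact (not_not.1 (hω n)).symm
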